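/- Let $(\mathcal X,d_0)$ be a compact metric space with $d_0\le 1$, equipped with its Borel $\sigma$-algebra, and let $\mathfrak N$ be the set of finite point measures $\sum_{i=1}^n\delta_{x_i}$ ($n\ge 0$, $x_i\in\mathcal X$), equipped with the smallest $\sigma$-algebra making the point counts $\xi\mapsto\xi(A)$ measurable for all measurable $A\subset\mathcal X$. For $\xi=\sum_{i=1}^m\delta_{x_i}$ and $\eta=\sum_{j=1}^n\delta_{y_j}$ with $n\ge\max(m,1)$ put $$\bar d_1(\xi,\eta)=\bar d_1(\eta,\xi)=\frac1n\Bigl(\min_{\pi\in\Pi_n}\sum_{i=1}^m d_0(x_i,y_{\pi(i)})+(n-m)\Bigr),\qquad \bar d_1(0,0)=0,$$ where $\Pi_n$ is the set of permutations of $\{1,\dots,n\}$. For probability measures $\mathcal P,\mathcal Q$ on $\mathfrak N$ let $$\bar d_2(\mathcal P,\mathcal Q)=\sup_f\Bigl|\int f\,d\mathcal P-\int f\,d\mathcal Q\Bigr|,$$ the supremum being over all $f:\mathfrak N\to[0,1]$ with $|f(\xi)-f(\eta)|\le\bar d_1(\xi,\eta)$ for all $\xi,\eta\in\mathfrak N$.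 For a distance function $d$ the Wasserstein distance of two probability measures $\mu,\nu$ is the infimum of $\mathbb E\,d(U,V)$ over all couplings $(U,V)$ of $U\sim\mu$ and $V\sim\nu$. Write $d_W$ for the Wasserstein distance on $\mathcal X$ with respect to $d_0$, and $d_{RW}$ for the one on $\mathbb Z_+=\{0,1,2,\dots\}$ with respect to $d_R(m,n)=|m-n|/\max(m,n)$, $d_R(0,0)=0$. Let $M$ and $N$ be $\mathbb Z_+$-valued random variables, let $(X_i)_{i\ge1}$ be a sequence of i.i.d. $\mathcal X$-valued random elements that is independent of $M$, and let $(Y_i)_{i\ge1}$ be a sequence of i.i.d. $\mathcal X$-valued random elements that is independent of $N$. Put $\Xi=\sum_{i=1}^M\delta_{X_i}$ and $\mathrm H=\sum_{i=1}^N\delta_{Y_i}$. Then there is a coupling $(\tilde M,\tilde N)$ of $\mathscr L(M)$ and $\mathscr L(N)$ with $\mathbb E\,d_R(\tilde M,\tilde N)=d_{RW}(\mathscr L(M),\mathscr L(N))$, and for every such coupling $$\max\bigl(d_{RW}(\mathscr L(M),\mathscr L(N)),\,c_1\,d_W(\mathscr L(X_1),\mathscr L(Y_1))\bigr)\le\bar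 d_2(\mathscr L(\Xi),\mathscr L(\mathrm H))\le d_{RW}(\mathscr L(M),\mathscr L(N))+c_2\,d_W(\mathscr L(X_1),\mathscr L(Y_1)),$$ where $$c_1=\max(\mathbb P[M>0],\mathbb P[N>0]),\qquad c_2=\mathbb E\Bigl(\frac{\tilde M\wedge\tilde N}{\tilde M\vee\tilde N}\mathbf 1_{\{\tilde M\vee\tilde N>0\}}\Bigr)\le\min(\mathbb P[M>0],\mathbb P[N>0]).$$ -/

import Mathlib

open MeasureTheory ProbabilityTheory

/-- The set of finite point measures on `X`: the measures `δ_{x₁} + ⋯ + δ_{xₙ}`, `n ≥ 0`.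
As a subtype of `Measure X` it carries the smallest σ-algebra for which all the point counts
`ξ ↦ ξ A`, `A` measurable, are measurable. -/
abbrev PointMeasure (X : Type*) [MeasurableSpace X] : Type _ :=
  {ξ : Measure X // ∃ (n : ℕ) (x : Fin n → X), ξ = ∑ i, Measure.dirac (x i)}

/-- The point measure `δ_{x₁} + ⋯ + δ_{xₙ}`. -/
noncomputable def pointMeasureOf {X : Type*} [MeasurableSpace X] {n : ℕ} (x : Fin n → X) :
    PointMeasure X :=
  ⟨∑ i, Measure.dirac (x i), n, x, rfl⟩

/-- The number of points of a point measure. -/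
noncomputable def PointMeasure.card {X : Type*} [MeasurableSpace X] (ξ : PointMeasure X) : ℕ :=
  ξ.2.choose

/-- An enumeration of the points of a point measure. -/
noncomputable def PointMeasure.points {X : Type*} [MeasurableSpace X] (ξ : PointMeasure X) :
    Fin ξ.card → X :=
  ξ.2.choose_spec.choose

theorem PointMeasure.eq_sum_points {X : Type*} [MeasurableSpace X] (ξ : PointMeasure X) :
    ξ.1 = ∑ i, Measure.dirac (ξ.points i) :=
  ξ.2.choose_spec.choose_spec

/-- For `m ≤ n`:
`(1/n) * (min_{π ∈ Πₙ} ∑_{i=1}^m d(x_i, y_{π(i)}) + (n - m))`, which is `0` for `m = n = 0`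
(division by zero gives zero). -/
noncomputable def tupleMatchDist {X : Type*} [PseudoMetricSpace X] {m n : ℕ} (h : m ≤ n)
    (x : Fin m → X) (y : Fin n → X) : ℝ :=
  ((⨅ π : Equiv.Perm (Fin n), ∑ i : Fin m, dist (x i) (y (π (Fin.castLE h i))))
    + ((n : ℝ) - (m : ℝ))) / (n : ℝ)

/-- The distance `d̄₁` on finite point measures. The shorter pattern is matched into the longer
one; the value does not depend on the enumerations (see `dOneBar_pointMeasureOf`). -/
noncomputable def dOneBar {X : Type*} [PseudoMetricSpace X] [MeasurableSpace X]
    (ξ η : PointMeasure X) : ℝ :=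
  if h : ξ.card ≤ η.card then tupleMatchDist h ξ.points η.points
  else tupleMatchDist (le_of_not_ge h) η.points ξ.points

/-- Two enumerations of the same point measure agree up to a bijection of the indices. -/
theorem exists_equiv_of_sum_dirac_eq {X : Type*} [MeasurableSpace X] [MeasurableSingletonClass X]
    {m n : ℕ} (x : Fin m → X) (y : Fin n → X)
    (h : ∑ i, Measure.dirac (x i) = ∑ j, Measure.dirac (y j)) :
    ∃ e : Fin m ≃ Fin n, ∀ i, y (e i) = x i := by
  classical
  have key : ∀ (k : ℕ) (z : Fin k → X) (a : X),
      (∑ i, Measure.dirac (z i)) {a} = (Fintype.card {i // z i = a} : ENNReal) := by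
    intro k z a
    rw [Measure.finsetSum_apply, Fintype.card_subtype, Finset.card_filter]
    push_cast
    refine Finset.sum_congr rfl fun i _ => ?_
    rw [Measure.dirac_apply' _ (measurableSet_singleton a)]
    simp [Set.indicator_apply]
  have hc : ∀ a, Fintype.card {i // x i = a} = Fintype.card {j // y j = a} := by
    intro a
    have := key m x a
    rw [h, key n y a] at this
    exact_mod_cast this.symm
  exact ⟨Equiv.ofFiberEquiv fun a => Fintype.equivOfCardEq (hc a),
    fun i => Equiv.ofFiberEquiv_map _ i⟩

theorem tupleMatchDist_comp {X : Type*} [PseudoMetricSpace X] {m n m' n' : ℕ} (h : m ≤ n)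
    (h' : m' ≤ n') (x : Fin m → X) (y : Fin n → X) (x' : Fin m' → X) (y' : Fin n' → X)
    (e : Fin m ≃ Fin m') (he : ∀ i, x' (e i) = x i) (f : Fin n ≃ Fin n')
    (hf : ∀ i, y' (f i) = y i) :
    tupleMatchDist h x y = tupleMatchDist h' x' y' := by
  classical
  obtain rfl : m = m' := Fin.equiv_iff_eq.1 ⟨e⟩
  obtain rfl : n = n' := Fin.equiv_iff_eq.1 ⟨f⟩
  unfold tupleMatchDist
  congr 2
  let g : Equiv.Perm (Fin n) := Equiv.Perm.viaFintypeEmbedding e (Fin.castLEEmb h)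
  have hg : ∀ i, g (Fin.castLE h i) = Fin.castLE h (e i) := fun i =>
    Equiv.Perm.viaFintypeEmbedding_apply_image e (Fin.castLEEmb h) i
  refine Equiv.iInf_congr ((Equiv.mulLeft f).trans (Equiv.mulRight g⁻¹)) fun π => ?_
  rw [← Equiv.sum_comp e]
  refine Finset.sum_congr rfl fun i _ => ?_
  have : ((Equiv.mulLeft f).trans (Equiv.mulRight g⁻¹)) π (Fin.castLE h (e i))
      = f (π (Fin.castLE h i)) := by
    rw [← hg i]
    simp
  rw [this, he, hf]

theorem tupleMatchDist_symm {X : Type*} [PseudoMetricSpace X] {n : ℕ} (x y : Fin n → X) :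
    tupleMatchDist le_rfl x y = tupleMatchDist le_rfl y x := by
  unfold tupleMatchDist
  congr 2
  refine Equiv.iInf_congr (Equiv.inv _) fun π => ?_
  rw [← Equiv.sum_comp π]
  refine Finset.sum_congr rfl fun i _ => ?_
  simp [dist_comm]

/-- `d̄₁` is given by the matching formula for every choice of the enumerations. -/
theorem dOneBar_pointMeasureOf {X : Type*} [PseudoMetricSpace X] [MeasurableSpace X]
    [MeasurableSingletonClass X] {m n : ℕ} (h : m ≤ n) (x : Fin m → X) (y : Fin n → X) :
    dOneBar (pointMeasureOf x) (pointMeasureOf y) = tupleMatchDist h x y ∧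
      dOneBar (pointMeasureOf y) (pointMeasureOf x) = tupleMatchDist h x y := by
  obtain ⟨e, he⟩ := exists_equiv_of_sum_dirac_eq _ _ (pointMeasureOf x).eq_sum_points.symm
  obtain ⟨f, hf⟩ := exists_equiv_of_sum_dirac_eq _ _ (pointMeasureOf y).eq_sum_points.symm
  have hm := Fin.equiv_iff_eq.1 ⟨e⟩
  have hn := Fin.equiv_iff_eq.1 ⟨f⟩
  unfold dOneBar
  refine ⟨?_, ?_⟩
  · rw [dif_pos (by omega)]
    exact tupleMatchDist_comp _ _ _ _ _ _ e he f hf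
  · split_ifs with h2
    · obtain rfl : m = n := by omega
      rw [tupleMatchDist_symm x y]
      exact tupleMatchDist_comp _ _ _ _ _ _ f hf e he
    · exact tupleMatchDist_comp _ _ _ _ _ _ e he f hf

/-- The class of functions `f : 𝔑 → [0,1]` with `|f ξ - f η| ≤ d̄₁(ξ, η)`. -/
def dOneBarLipschitz (X : Type*) [PseudoMetricSpace X] [MeasurableSpace X] :
    Set (PointMeasure X → ℝ) :=
  {f | (∀ ξ, 0 ≤ f ξ ∧ f ξ ≤ 1) ∧ ∀ ξ η, |f ξ - f η| ≤ dOneBar ξ η}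

/-- The distance `d̄₂` between distributions of point processes. -/
noncomputable def dTwoBar {X : Type*} [PseudoMetricSpace X] [MeasurableSpace X]
    (P Q : Measure (PointMeasure X)) : ℝ :=
  sSup ((fun f : PointMeasure X → ℝ => |∫ ξ, f ξ ∂P - ∫ ξ, f ξ ∂Q|) '' dOneBarLipschitz X)

/-- The relative difference metric `|m - n| / max(m, n)` on `ℕ`, with value `0` at `(0, 0)`
(division by zero gives zero). -/
noncomputable def relDiff (m n : ℕ) : ℝ := |(m : ℝ) - (n : ℝ)| / max (m : ℝ) (n : ℝ)

/-- `γ` is a coupling of `μ` and `ν`. -/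
def IsCoupling {α : Type*} [MeasurableSpace α] (γ : Measure (α × α)) (μ ν : Measure α) : Prop :=
  γ.map Prod.fst = μ ∧ γ.map Prod.snd = ν

/-- The Wasserstein distance with respect to the distance function `d`: the infimum of
`E d(U, V)` over all couplings of `U ∼ μ` and `V ∼ ν`. -/
noncomputable def wassersteinDist {α : Type*} [MeasurableSpace α] (d : α → α → ℝ)
    (μ ν : Measure α) : ℝ :=
  sInf {r : ℝ | ∃ γ : Measure (α × α), IsCoupling γ μ ν ∧ r = ∫ p, d p.1 p.2 ∂γ}

/-- `γ` is a coupling of `μ` and `ν` that attains the Wasserstein distance with respect to `d`. -/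
def IsOptimalCoupling {α : Type*} [MeasurableSpace α] (d : α → α → ℝ) (γ : Measure (α × α))
    (μ ν : Measure α) : Prop :=
  IsCoupling γ μ ν ∧ ∫ p, d p.1 p.2 ∂γ = wassersteinDist d μ ν

/-- The constant `c₂ = E[(M̃ ∧ Ñ) / (M̃ ∨ Ñ) * 1{M̃ ∨ Ñ > 0}]` for `(M̃, Ñ) ∼ γ`. -/
noncomputable def cTwo (γ : Measure (ℕ × ℕ)) : ℝ :=
  ∫ p, Set.indicator {q : ℕ × ℕ | 0 < max q.1 q.2}
    (fun q => min (q.1 : ℝ) (q.2 : ℝ) / max (q.1 : ℝ) (q.2 : ℝ)) p ∂γ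

/-- The point process `ω ↦ ∑_{i < K ω} δ_{Z i ω}`. -/
noncomputable def pointProcessOf {Ω X : Type*} [MeasurableSpace X] (K : Ω → ℕ) (Z : ℕ → Ω → X)
    (ω : Ω) : PointMeasure X :=
  pointMeasureOf fun i : Fin (K ω) => Z i ω

/-! Upper bound. Given numbers of points `m` and `n`, draw `max m n` independent pairs from a
coupling of the two point laws and match equal indices. The expected `dOneBar` of the two patterns
is at most `relDiff m n` plus `min m n / max m n` times the expected distance within a pair.
Averaging over an optimal coupling of the counts turns the first term into its Wasserstein distance
and the weight into `cTwo`; the infimum over couplings of the point laws finishes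
(`abs_integral_pi_sub_le_relDiff_add`).

Lower bound. Two families of functions are admissible in the supremum: functions of the number of
points that are Lipschitz for `relDiff` (`comp_card_mem_dOneBarLipschitz`), and averages over the
points of a Lipschitz `g`, with an arbitrary value in `[0,1]` at the zero measure
(`pointAverage_mem_dOneBarLipschitz`). A suitable value there makes one of the two laws contribute
nothing, which leaves the factor `P[M > 0]` or `P[N > 0]`.

To compare these with Wasserstein distances, Kantorovich-Rubinstein duality is needed, but only up
to `ε`: quantization leads to a finite transport problem, where separation of convex sets yields
dual potentials (`exists_lipschitz_wassersteinDist_lt`). The optimal coupling of the counts comes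
from Prokhorov compactness. Admissible functions are not assumed measurable; they are limits of
functions of finitely many point counts (`measurable_of_mem_dOneBarLipschitz`). -/

/-! ### Duality for finite transport problems -/

/-- Weak duality gap for the finite transport problem: a strict lower bound `t` of all transport
costs is beaten by a pair of dual potentials. -/

theorem exists_dual_potentials_of_lt_cost {ι : Type*} [Fintype ι] (D : ι → ι → ℝ)
    (a b : ι → ℝ) (ha : ∀ i, 0 ≤ a i) (hb : ∀ i, 0 ≤ b i) (ha1 : ∑ i, a i = 1)
    (hb1 : ∑ i, b i = 1) (t : ℝ)
    (ht : ∀ p : ι × ι → ℝ, (∀ x, 0 ≤ p x) → (∀ i, ∑ j, p (i, j) = a i) →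
      (∀ j, ∑ i, p (i, j) = b j) → t < ∑ x, p x * D x.1 x.2) :
    ∃ u v : ι → ℝ, (∀ i j, u i + v j ≤ D i j) ∧ t < ∑ i, a i * u i + ∑ j, b j * v j := by
  classical
  let T : (ι × ι → ℝ) →ₗ[ℝ] (ι → ℝ) × (ι → ℝ) × ℝ :=
    { toFun := fun p => (fun i => ∑ j, p (i, j), fun j => ∑ i, p (i, j), ∑ x, p x * D x.1 x.2)
      map_add' := by
        intro p q
        ext <;> simp [Finset.sum_add_distrib, add_mul]
      map_smul' := by
        intro c p
        ext <;> simp [Finset.mul_sum, mul_assoc] }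
  have hTc : Continuous T := T.continuous_of_finiteDimensional
  have hB : IsCompact (T '' stdSimplex ℝ (ι × ι)) := (isCompact_stdSimplex ℝ (ι × ι)).image hTc
  have hBc : Convex ℝ (T '' stdSimplex ℝ (ι × ι)) := (convex_stdSimplex ℝ (ι × ι)).linear_image T
  -- The target has the prescribed marginals and cost at most `t`; `ht` says exactly that no plan
  -- reaches it.
  let R : Set ((ι → ℝ) × (ι → ℝ) × ℝ) := {a} ×ˢ ({b} ×ˢ Set.Iic t)
  have hR : IsClosed R := isClosed_singleton.prod (isClosed_singleton.prod isClosed_Iic)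
  have hRc : Convex ℝ R := (convex_singleton a).prod ((convex_singleton b).prod (convex_Iic t))
  have hdisj : Disjoint (T '' stdSimplex ℝ (ι × ι)) R := by
    rw [Set.disjoint_left]
    rintro _ ⟨p, hp, rfl⟩ ⟨h1, h2, h3⟩
    simp only [T, LinearMap.coe_mk, AddHom.coe_mk, Set.mem_singleton_iff, Set.mem_Iic] at h1 h2 h3
    exact absurd h3 (not_le.2 (ht p hp.1 (fun i => congrFun h1 i) (fun j => congrFun h2 j)))
  obtain ⟨f, s, r, hfs, hsr, hfr⟩ := geometric_hahn_banach_compact_closed hBc hB hRc hR hdisj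
  let φ : ι → ℝ := fun i => f (Pi.single i 1, 0, 0)
  let ψ : ι → ℝ := fun j => f (0, Pi.single j 1, 0)
  let c : ℝ := f (0, 0, 1)
  have hf : ∀ (x y : ι → ℝ) (z : ℝ), f (x, y, z) = ∑ i, x i * φ i + ∑ j, y j * ψ j + z * c := by
    intro x y z
    have h1 : (x, y, z) = ∑ i, x i • ((Pi.single i 1, 0, 0) : (ι → ℝ) × (ι → ℝ) × ℝ)
        + ∑ j, y j • ((0, Pi.single j 1, 0) : (ι → ℝ) × (ι → ℝ) × ℝ)
        + z • ((0, 0, 1) : (ι → ℝ) × (ι → ℝ) × ℝ) := by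
      refine Prod.ext ?_ (Prod.ext ?_ ?_)
      · ext k; simp [Prod.fst_sum, Finset.sum_apply, Pi.single_apply]
      · ext k; simp [Prod.fst_sum, Prod.snd_sum, Finset.sum_apply, Pi.single_apply]
      · simp [Prod.snd_sum]
    rw [h1]
    simp only [map_add, map_sum, map_smul, smul_eq_mul]
    rfl
  have hvert : ∀ i j, φ i + ψ j + D i j * c < s := by
    intro i j
    have := hfs (T (Pi.single (i, j) 1)) ⟨_, single_mem_stdSimplex ℝ (i, j), rfl⟩
    have h2 : T (Pi.single (i, j) 1) = (Pi.single i 1, Pi.single j 1, D i j) := by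
      refine Prod.ext ?_ (Prod.ext ?_ ?_)
      · ext k
        by_cases h : k = i
        · simpa [T, Pi.single_apply, h] using Finset.card_eq_one.2 ⟨j, by ext; simp⟩
        · simp [T, Pi.single_apply, h]
      · ext k
        by_cases h : k = j
        · simpa [T, Pi.single_apply, h] using Finset.card_eq_one.2 ⟨i, by ext; simp⟩
        · simp [T, Pi.single_apply, h]
      · simp [T, Pi.single_apply]
    rw [h2, hf] at this
    simpa [Pi.single_apply] using this
  have hray : ∀ z ≤ t, r < ∑ i, a i * φ i + ∑ j, b j * ψ j + z * c := by
    intro z hz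
    rw [← hf]
    exact hfr _ ⟨rfl, rfl, hz⟩
  set A := ∑ i, a i * φ i
  set B := ∑ j, b j * ψ j
  -- `R` contains a ray on which the cost tends to `-∞`, and `f` is bounded below there.
  have hc0 : c ≤ 0 := by
    by_contra! hc
    have h1 := hray (min t ((r - A - B) / c)) (min_le_left _ _)
    have h2 : min t ((r - A - B) / c) * c ≤ (r - A - B) / c * c :=
      mul_le_mul_of_nonneg_right (min_le_right _ _) hc.le
    rw [div_mul_cancel₀ _ hc.ne'] at h2
    linarith
  have havg : ∀ w : ι → ι → ℝ, (∀ i j, w i j ≤ s) → ∑ i, ∑ j, a i * b j * w i j ≤ s := by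
    intro w hw
    calc ∑ i, ∑ j, a i * b j * w i j ≤ ∑ i, ∑ j, a i * b j * s :=
          Finset.sum_le_sum fun i _ => Finset.sum_le_sum fun j _ =>
            mul_le_mul_of_nonneg_left (hw i j) (mul_nonneg (ha i) (hb j))
      _ = s := by simp [← Finset.sum_mul, ← Finset.mul_sum, ha1, hb1]
  -- For `c = 0`, averaging the vertex inequalities against the product plan `a i * b j` would give
  -- `A + B ≤ s`, whereas `s < r < A + B`.
  have hc : c < 0 := by
    refine lt_of_le_of_ne hc0 fun hc => ?_
    have h1 := havg (fun i j => φ i + ψ j) fun i j => by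
      have := hvert i j
      rw [hc] at this
      linarith
    have h2 : ∑ i, ∑ j, a i * b j * (φ i + ψ j) = A + B := by
      simp only [mul_add, Finset.sum_add_distrib]
      congr 1
      · simp only [← Finset.sum_mul, ← Finset.mul_sum, hb1, mul_one, A]
      · rw [Finset.sum_comm]
        simp only [← Finset.sum_mul, ha1, one_mul, B]
    have h3 := hray t le_rfl
    rw [hc] at h3
    linarith
  -- Dividing by `-c > 0` gives the cost coefficient one; the constant `s` is absorbed into the
  -- second potential, as `b` has total mass one.
  refine ⟨fun i => φ i / (-c), fun j => (ψ j - s) / (-c), fun i j => ?_, ?_⟩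
  · rw [← add_div, div_le_iff₀ (by linarith)]
    linarith [hvert i j]
  · have h1 : ∑ i, a i * (φ i / (-c)) + ∑ j, b j * ((ψ j - s) / (-c)) = (A + B - s) / (-c) := by
      have e1 : ∑ i, a i * (φ i / (-c)) = A / (-c) := by
        simp only [A, Finset.sum_div, mul_div_assoc]
      have e2 : ∑ j, b j * ((ψ j - s) / (-c)) = (B - s) / (-c) := by
        have : ∀ j, b j * ((ψ j - s) / (-c)) = (b j * ψ j - b j * s) / (-c) := fun j => by ring
        simp only [this, ← Finset.sum_div, Finset.sum_sub_distrib, ← Finset.sum_mul, hb1, one_mul, B]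
      rw [e1, e2, ← add_div]
      ring
    rw [h1, lt_div_iff₀ (by linarith)]
    linarith [hray t le_rfl]

/-! ### Couplings and the Wasserstein distance -/

theorem IsCoupling.isProbabilityMeasure {α : Type*} [MeasurableSpace α] {γ : Measure (α × α)}
    {μ ν : Measure α} [IsProbabilityMeasure μ] (h : IsCoupling γ μ ν) : IsProbabilityMeasure γ := by
  have : IsProbabilityMeasure (γ.map Prod.fst) := by rw [h.1]; infer_instance
  exact Measure.isProbabilityMeasure_of_map (μ := γ) Prod.fst

theorem isCoupling_prod {α : Type*} [MeasurableSpace α] (μ ν : Measure α)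
    [IsProbabilityMeasure μ] [IsProbabilityMeasure ν] : IsCoupling (μ.prod ν) μ ν :=
  ⟨by simp, by simp⟩

theorem wassersteinDist_le_integral {α : Type*} [MeasurableSpace α] {d : α → α → ℝ}
    (hd : ∀ x y, 0 ≤ d x y) {γ : Measure (α × α)} {μ ν : Measure α} (h : IsCoupling γ μ ν) :
    wassersteinDist d μ ν ≤ ∫ p, d p.1 p.2 ∂γ := by
  refine csInf_le ⟨0, ?_⟩ ⟨γ, h, rfl⟩
  rintro _ ⟨γ', _, rfl⟩
  exact integral_nonneg fun p => hd _ _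

theorem wassersteinDist_nonneg {α : Type*} [MeasurableSpace α] {d : α → α → ℝ}
    (hd : ∀ x y, 0 ≤ d x y) (μ ν : Measure α) : 0 ≤ wassersteinDist d μ ν := by
  refine Real.sInf_nonneg ?_
  rintro _ ⟨γ', _, rfl⟩
  exact integral_nonneg fun p => hd _ _

/-! ### Approximate Kantorovich-Rubinstein duality -/

/-- A transport plan between the distributions of a finite-valued `g` lifts to a coupling. -/

theorem exists_isCoupling_of_plan {α ι : Type*} [MeasurableSpace α] [Fintype ι]
    (μ ν : Measure α) [IsProbabilityMeasure μ] [IsProbabilityMeasure ν] (g : α → ι)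
    (hg : ∀ i, MeasurableSet (g ⁻¹' {i})) (p : ι × ι → ℝ) (hp : ∀ x, 0 ≤ p x)
    (hp1 : ∀ i, ∑ j, p (i, j) = μ.real (g ⁻¹' {i}))
    (hp2 : ∀ j, ∑ i, p (i, j) = ν.real (g ⁻¹' {j})) :
    ∃ γ : Measure (α × α), IsCoupling γ μ ν ∧
      ∀ D : ι → ι → ℝ, ∫ z, D (g z.1) (g z.2) ∂γ = ∑ x, p x * D x.1 x.2 := by
  classical
  -- A charged cell of the plan has marginals of positive mass, so conditioning on them gives
  -- probability measures; all other cells have weight zero.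
  have hne1 : ∀ x : ι × ι, p x ≠ 0 → μ (g ⁻¹' {x.1}) ≠ 0 := by
    intro x hx h0
    have h1 := hp1 x.1
    rw [Measure.real, h0, ENNReal.toReal_zero, Finset.sum_eq_zero_iff_of_nonneg fun _ _ => hp _]
      at h1
    exact hx (h1 x.2 (Finset.mem_univ _))
  have hne2 : ∀ x : ι × ι, p x ≠ 0 → ν (g ⁻¹' {x.2}) ≠ 0 := by
    intro x hx h0
    have h1 := hp2 x.2
    rw [Measure.real, h0, ENNReal.toReal_zero, Finset.sum_eq_zero_iff_of_nonneg fun _ _ => hp _]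
      at h1
    exact hx (h1 x.1 (Finset.mem_univ _))
  have htot : ∀ (ρ : Measure α) [IsProbabilityMeasure ρ],
      ∑ i, ρ (g ⁻¹' {i}) • ρ[|g ⁻¹' {i}] = ρ := by
    intro ρ _
    ext A hA
    rw [Measure.finsetSum_apply]
    simp only [Measure.smul_apply, smul_eq_mul]
    have h1 : ∀ i, ρ (g ⁻¹' {i}) * ρ[|g ⁻¹' {i}] A = ρ (g ⁻¹' {i} ∩ A) := by
      intro i
      rw [mul_comm, cond_mul_eq_inter (hg i)]
    simp only [h1]
    rw [← measure_biUnion_finset]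
    · congr 1; ext x; simp
    · intro i _ j _ hij
      refine Set.disjoint_left.2 fun x hx hx' => hij ?_
      rw [← (show g x = i from hx.1), ← (show g x = j from hx'.1)]
    · exact fun i _ => (hg i).inter hA
  -- Choose a pair of cells according to `p`, then independent points from the conditional laws on
  -- these cells.
  let γ : Measure (α × α) :=
    ∑ x : ι × ι, ENNReal.ofReal (p x) • (μ[|g ⁻¹' {x.1}]).prod (ν[|g ⁻¹' {x.2}])
  refine ⟨γ, ⟨?_, ?_⟩, ?_⟩
  · have h1 : γ.map Prod.fst = ∑ x : ι × ι, ENNReal.ofReal (p x) • μ[|g ⁻¹' {x.1}] := by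
      simp only [γ]
      rw [← Measure.mapₗ_apply_of_measurable measurable_fst, map_sum]
      refine Finset.sum_congr rfl fun x _ => ?_
      rw [Measure.mapₗ_apply_of_measurable measurable_fst, Measure.map_smul]
      by_cases hx : p x = 0
      · simp [hx]
      · have := cond_isProbabilityMeasure (hne2 x hx)
        simp
    rw [h1, Fintype.sum_prod_type]
    simp only [← Finset.sum_smul]
    conv_rhs => rw [← htot μ]
    refine Finset.sum_congr rfl fun i _ => ?_
    rw [← ENNReal.ofReal_sum_of_nonneg fun _ _ => hp _, hp1, ofReal_measureReal]
  · have h1 : γ.map Prod.snd = ∑ x : ι × ι, ENNReal.ofReal (p x) • ν[|g ⁻¹' {x.2}] := by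
      simp only [γ]
      rw [← Measure.mapₗ_apply_of_measurable measurable_snd, map_sum]
      refine Finset.sum_congr rfl fun x _ => ?_
      rw [Measure.mapₗ_apply_of_measurable measurable_snd, Measure.map_smul]
      by_cases hx : p x = 0
      · simp [hx]
      · have := cond_isProbabilityMeasure (hne1 x hx)
        simp
    rw [h1, Fintype.sum_prod_type_right]
    simp only [← Finset.sum_smul]
    conv_rhs => rw [← htot ν]
    refine Finset.sum_congr rfl fun i _ => ?_
    rw [← ENNReal.ofReal_sum_of_nonneg fun _ _ => hp _, hp2, ofReal_measureReal]
  · intro D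
    let _ : MeasurableSpace ι := ⊤
    have hgm : Measurable g := measurable_to_countable' fun i => hg i
    have hDm : Measurable fun z : α × α => D (g z.1) (g z.2) :=
      (measurable_of_countable (fun x : ι × ι => D x.1 x.2)).comp
        ((hgm.comp measurable_fst).prodMk (hgm.comp measurable_snd))
    have hbd : ∀ z : α × α, ‖D (g z.1) (g z.2)‖ ≤ ∑ x : ι × ι, ‖D x.1 x.2‖ := fun z =>
      Finset.single_le_sum (f := fun x : ι × ι => ‖D x.1 x.2‖) (fun _ _ => norm_nonneg _)
        (Finset.mem_univ (g z.1, g z.2))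
    simp only [γ]
    rw [integral_finsetSum_measure]
    · refine Finset.sum_congr rfl fun x _ => ?_
      rw [integral_smul_measure, ENNReal.toReal_ofReal (hp x), smul_eq_mul]
      by_cases hx : p x = 0
      · simp [hx]
      · have h1 := cond_isProbabilityMeasure (hne1 x hx)
        have h2 := cond_isProbabilityMeasure (hne2 x hx)
        congr 1
        have hae : ∀ᵐ z ∂(μ[|g ⁻¹' {x.1}]).prod (ν[|g ⁻¹' {x.2}]),
            D (g z.1) (g z.2) = D x.1 x.2 := by
          have e1 : ∀ᵐ z ∂(μ[|g ⁻¹' {x.1}]).prod (ν[|g ⁻¹' {x.2}]), g z.1 = x.1 :=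
            Measure.quasiMeasurePreserving_fst.ae (ae_cond_mem (hg x.1))
          have e2 : ∀ᵐ z ∂(μ[|g ⁻¹' {x.1}]).prod (ν[|g ⁻¹' {x.2}]), g z.2 = x.2 :=
            Measure.quasiMeasurePreserving_snd.ae (ae_cond_mem (hg x.2))
          filter_upwards [e1, e2] with z hz1 hz2
          rw [hz1, hz2]
        rw [integral_congr_ae hae]
        simp
    · intro x _
      refine Integrable.smul_measure ?_ ENNReal.ofReal_ne_top
      exact Integrable.of_bound hDm.aestronglyMeasurable _ (Filter.Eventually.of_forall hbd)

/-- Approximate Kantorovich-Rubinstein duality for a bounded pseudometric that is approximated by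
a finite-valued map on average. -/

theorem exists_lipschitz_wassersteinDist_lt {α ι : Type*} [MeasurableSpace α] [Fintype ι]
    (d : α → α → ℝ) (hdm : Measurable fun z : α × α => d z.1 z.2) (hd0 : ∀ x y, 0 ≤ d x y)
    (hd1 : ∀ x y, d x y ≤ 1) (hdsymm : ∀ x y, d x y = d y x)
    (hdtri : ∀ x y z, d x z ≤ d x y + d y z)
    (μ ν : Measure α) [IsProbabilityMeasure μ] [IsProbabilityMeasure ν] (g : α → ι)
    (hg : ∀ i, MeasurableSet (g ⁻¹' {i})) (c : ι → α) {ε : ℝ} (hε : 0 < ε)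
    (hμ : ∫ x, d x (c (g x)) ∂μ ≤ ε) (hν : ∫ x, d x (c (g x)) ∂ν ≤ ε) :
    ∃ h : α → ℝ, Measurable h ∧ (∀ x, 0 ≤ h x ∧ h x ≤ 1) ∧ (∀ x y, |h x - h y| ≤ d x y) ∧
      wassersteinDist d μ ν < ∫ x, h x ∂μ - ∫ x, h x ∂ν + 5 * ε := by
  classical
  have hα : Nonempty α := nonempty_of_isProbabilityMeasure μ
  have hι : Nonempty ι := hα.map g
  let _ : MeasurableSpace ι := ⊤
  have hgm : Measurable g := measurable_to_countable' fun i => hg i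
  have hcm : Measurable fun x => c (g x) := (measurable_of_countable c).comp hgm
  have hdgm : Measurable fun x => d x (c (g x)) := hdm.comp (measurable_id.prodMk hcm)
  have hint : ∀ {β : Type _} [MeasurableSpace β] (ρ : Measure β) [IsProbabilityMeasure ρ]
      (F G : β → α), Measurable F → Measurable G → Integrable (fun z => d (F z) (G z)) ρ := by
    intro β _ ρ _ F G hF hG
    refine Integrable.of_bound (hdm.comp (hF.prodMk hG)).aestronglyMeasurable 1
      (Filter.Eventually.of_forall fun z => ?_)
    rw [Real.norm_eq_abs, abs_of_nonneg (hd0 _ _)]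
    exact hd1 _ _
  have hintf : ∀ (ρ : Measure α) [IsProbabilityMeasure ρ] (w : ι → ℝ),
      Integrable (fun x => w (g x)) ρ := by
    intro ρ _ w
    refine Integrable.of_bound ((measurable_of_countable w).comp hgm).aestronglyMeasurable
      (∑ i, ‖w i‖) (Filter.Eventually.of_forall fun x => ?_)
    exact Finset.single_le_sum (f := fun i => ‖w i‖) (fun _ _ => norm_nonneg _)
      (Finset.mem_univ (g x))
  have hsum : ∀ (ρ : Measure α) [IsProbabilityMeasure ρ] (w : ι → ℝ),
      ∑ i, ρ.real (g ⁻¹' {i}) * w i = ∫ x, w (g x) ∂ρ := by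
    intro ρ _ w
    have h1 : ∫ x, w (g x) ∂ρ = ∫ i, w i ∂(ρ.map g) :=
      (integral_map hgm.aemeasurable
        (measurable_of_countable w).aestronglyMeasurable).symm
    have := Measure.isProbabilityMeasure_map (μ := ρ) hgm.aemeasurable
    rw [h1, integral_fintype (Integrable.of_finite)]
    refine Finset.sum_congr rfl fun i _ => ?_
    rw [map_measureReal_apply hgm (measurableSet_singleton i), smul_eq_mul]
  have hone : ∀ (ρ : Measure α) [IsProbabilityMeasure ρ], ∑ i, ρ.real (g ⁻¹' {i}) = 1 := by
    intro ρ _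
    have := hsum ρ fun _ => 1
    simpa using this
  obtain ⟨u, v, huv, hlt⟩ := exists_dual_potentials_of_lt_cost (fun i j => d (c i) (c j))
    (fun i => μ.real (g ⁻¹' {i})) (fun i => ν.real (g ⁻¹' {i})) (fun _ => measureReal_nonneg)
    -- Moving both points to their cell centres changes the cost of a lifted plan by at most `2 *
    -- ε`; the third `ε` makes the inequality strict.
    (fun _ => measureReal_nonneg) (hone μ) (hone ν) (wassersteinDist d μ ν - 3 * ε) (by
      intro p hp hp1 hp2
      obtain ⟨γ, hγ, hγD⟩ := exists_isCoupling_of_plan μ ν g hg p hp hp1 hp2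
      have := hγ.isProbabilityMeasure
      have h1 := wassersteinDist_le_integral hd0 hγ
      have e1 : ∫ z, d z.1 (c (g z.1)) ∂γ ≤ ε := by
        rw [← hγ.1, integral_map measurable_fst.aemeasurable hdgm.aestronglyMeasurable] at hμ
        exact hμ
      have e2 : ∫ z, d z.2 (c (g z.2)) ∂γ ≤ ε := by
        rw [← hγ.2, integral_map measurable_snd.aemeasurable hdgm.aestronglyMeasurable] at hν
        exact hν
      have i1 := hint γ (fun z => z.1) (fun z => c (g z.1)) measurable_fst
        (hcm.comp measurable_fst)
      have i2 := hint γ (fun z => z.2) (fun z => c (g z.2)) measurable_snd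
        (hcm.comp measurable_snd)
      have i3 := hint γ (fun z => c (g z.1)) (fun z => c (g z.2)) (hcm.comp measurable_fst)
        (hcm.comp measurable_snd)
      have h2 : ∫ z, d z.1 z.2 ∂γ
          ≤ ∫ z, (d z.1 (c (g z.1)) + d (c (g z.1)) (c (g z.2)) + d z.2 (c (g z.2))) ∂γ := by
        refine integral_mono (hint γ _ _ measurable_fst measurable_snd) ((i1.add i3).add i2) ?_
        intro z
        have a1 := hdtri z.1 (c (g z.1)) z.2
        have a2 := hdtri (c (g z.1)) (c (g z.2)) z.2
        rw [hdsymm (c (g z.2)) z.2] at a2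
        dsimp only
        linarith
      have h4 : ∫ z, (d z.1 (c (g z.1)) + d (c (g z.1)) (c (g z.2)) + d z.2 (c (g z.2))) ∂γ
          = ∫ z, d z.1 (c (g z.1)) ∂γ + ∫ z, d (c (g z.1)) (c (g z.2)) ∂γ
            + ∫ z, d z.2 (c (g z.2)) ∂γ := by
        rw [← integral_add i1 i3]
        exact integral_add (i1.add i3) i2
      have h3 := hγD fun i j => d (c i) (c j)
      linarith)
  -- The transform of `v` with respect to the cost extends the potentials to all of `α`. As an
  -- infimum of 1-Lipschitz functions it is 1-Lipschitz; up to the quantization error it dominates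
  -- `u` and is dominated by `-v`.
  let h : α → ℝ := fun x => ⨅ j, (d x (c j) - v j)
  have hbdd : ∀ x, BddBelow (Set.range fun j => d x (c j) - v j) := fun x =>
    (Set.finite_range _).bddBelow
  have hm : Measurable h := Measurable.iInf fun j =>
    (hdm.comp (measurable_id.prodMk measurable_const)).sub_const _
  have hlip1 : ∀ x y, h x ≤ h y + d x y := by
    intro x y
    rw [← sub_le_iff_le_add]
    refine le_ciInf fun j => ?_
    have h1 : h x ≤ d x (c j) - v j := ciInf_le (hbdd x) j
    linarith [hdtri x y (c j)]
  have hlip : ∀ x y, |h x - h y| ≤ d x y := by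
    intro x y
    rw [abs_le]
    constructor
    · linarith [hlip1 y x, hdsymm x y]
    · linarith [hlip1 x y]
  have hlow : ∀ x, u (g x) - d x (c (g x)) ≤ h x := by
    intro x
    have h1 : u (g x) ≤ h (c (g x)) := le_ciInf fun j => by linarith [huv (g x) j]
    linarith [hlip1 (c (g x)) x, hdsymm x (c (g x))]
  have hup : ∀ x, h x ≤ d x (c (g x)) - v (g x) := fun x => ciInf_le (hbdd x) (g x)
  obtain ⟨x₀⟩ := id hα
  have hbelow : BddBelow (Set.range h) := by
    refine ⟨h x₀ - 1, ?_⟩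
    rintro _ ⟨x, rfl⟩
    linarith [hlip1 x₀ x, hd1 x₀ x]
  let k := ⨅ x, h x
  have hk1 : ∀ x, h x ≤ k + 1 := by
    intro x
    rw [← sub_le_iff_le_add]
    exact le_ciInf fun y => by linarith [hlip1 x y, hd1 x y]
  have hinth : ∀ (ρ : Measure α) [IsProbabilityMeasure ρ], Integrable h ρ := by
    intro ρ _
    refine Integrable.of_bound hm.aestronglyMeasurable (|h x₀| + 1)
      (Filter.Eventually.of_forall fun x => ?_)
    rw [Real.norm_eq_abs]
    have h1 := abs_sub_abs_le_abs_sub (h x) (h x₀)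
    linarith [hlip x x₀, hd1 x x₀]
  -- Since `d ≤ 1`, `h` oscillates by at most one. Replacing the potentials by `h` costs `ε` under
  -- each law, hence `5 * ε` with the `3 * ε` above.
  refine ⟨fun x => h x - k, hm.sub_const _, fun x => ⟨?_, ?_⟩, fun x y => ?_, ?_⟩
  · linarith [show k ≤ h x from ciInf_le hbelow x]
  · linarith [hk1 x]
  · simpa using hlip x y
  · have hdi : ∀ (ρ : Measure α) [IsProbabilityMeasure ρ],
        Integrable (fun x => d x (c (g x))) ρ := fun ρ _ => hint ρ _ _ measurable_id hcm
    have e1 : ∫ x, (u (g x) - d x (c (g x))) ∂μ ≤ ∫ x, h x ∂μ :=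
      integral_mono ((hintf μ u).sub (hdi μ)) (hinth μ) hlow
    have e2 : ∫ x, h x ∂ν ≤ ∫ x, (d x (c (g x)) - v (g x)) ∂ν :=
      integral_mono (hinth ν) ((hdi ν).sub (hintf ν v)) hup
    rw [integral_sub (hintf μ u) (hdi μ)] at e1
    rw [integral_sub (hdi ν) (hintf ν v)] at e2
    rw [hsum μ u, hsum ν v] at hlt
    rw [integral_sub (hinth μ) (integrable_const _), integral_sub (hinth ν) (integrable_const _)]
    simp only [integral_const, probReal_univ, one_smul]
    linarith

/-! ### Existence of optimal couplings -/

theorem measure_coupling_prod_compl_le {α : Type*} [MeasurableSpace α] {γ : Measure (α × α)}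
    {μ ν : Measure α} (h : IsCoupling γ μ ν) {K L : Set α} (hK : MeasurableSet K)
    (hL : MeasurableSet L) : γ (K ×ˢ L)ᶜ ≤ μ Kᶜ + ν Lᶜ := by
  rw [← h.1, ← h.2, Measure.map_apply measurable_fst hK.compl,
    Measure.map_apply measurable_snd hL.compl]
  refine (measure_mono ?_).trans (measure_union_le _ _)
  intro z hz
  simp only [Set.mem_compl_iff, Set.mem_prod, Set.mem_union, Set.mem_preimage] at hz ⊢
  tauto

/-- A bounded continuous nonnegative cost on a Polish space admits an optimal coupling. -/

theorem exists_isOptimalCoupling {α : Type*} [TopologicalSpace α] [PolishSpace α]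
    [MeasurableSpace α] [BorelSpace α] (d : α → α → ℝ)
    (hdc : Continuous fun z : α × α => d z.1 z.2) (hd0 : ∀ x y, 0 ≤ d x y)
    (hd1 : ∀ x y, d x y ≤ 1) (μ ν : Measure α) [IsProbabilityMeasure μ] [IsProbabilityMeasure ν] :
    ∃ γ, IsOptimalCoupling d γ μ ν := by
  let S : Set (ProbabilityMeasure (α × α)) := {γ | IsCoupling (γ : Measure (α × α)) μ ν}
  let μ' : ProbabilityMeasure α := ⟨μ, inferInstance⟩
  let ν' : ProbabilityMeasure α := ⟨ν, inferInstance⟩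
  have hS : S = {γ | γ.map measurable_fst.aemeasurable = μ'}
      ∩ {γ | γ.map measurable_snd.aemeasurable = ν'} := by
    ext γ
    simp only [S, IsCoupling, Set.mem_ofPred_eq, Set.mem_inter_iff]
    exact and_congr ⟨fun h => Subtype.ext h, fun h => congrArg Subtype.val h⟩
      ⟨fun h => Subtype.ext h, fun h => congrArg Subtype.val h⟩
  have hSclosed : IsClosed S := by
    rw [hS]
    exact (isClosed_eq (ProbabilityMeasure.continuous_map continuous_fst)
      continuous_const).inter (isClosed_eq (ProbabilityMeasure.continuous_map continuous_snd)
      continuous_const)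
  -- Both marginals are fixed and each is tight, so products of compact sets serve all couplings at
  -- once; Prokhorov's theorem then gives compactness.
  have htight : IsTightMeasureSet {((γ : ProbabilityMeasure (α × α)) : Measure (α × α)) | γ ∈ S} := by
    rw [isTightMeasureSet_iff_exists_isCompact_measure_compl_le]
    intro ε hε
    have hε2 : 0 < ε / 2 := ENNReal.half_pos hε.ne'
    obtain ⟨K, hK, hKμ⟩ := isTightMeasureSet_iff_exists_isCompact_measure_compl_le.1
      (isTightMeasureSet_singleton (μ := μ)) (ε / 2) hε2
    obtain ⟨L, hL, hLν⟩ := isTightMeasureSet_iff_exists_isCompact_measure_compl_le.1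
      (isTightMeasureSet_singleton (μ := ν)) (ε / 2) hε2
    refine ⟨K ×ˢ L, hK.prod hL, ?_⟩
    rintro _ ⟨γ, hγ, rfl⟩
    refine (measure_coupling_prod_compl_le hγ hK.measurableSet hL.measurableSet).trans ?_
    rw [← ENNReal.add_halves ε]
    exact add_le_add (hKμ _ rfl) (hLν _ rfl)
  have hcomp : IsCompact S := by
    have := isCompact_closure_of_isTightMeasureSet htight
    rwa [hSclosed.closure_eq] at this
  let D : BoundedContinuousFunction (α × α) ℝ :=
    BoundedContinuousFunction.ofNormedAddCommGroup (fun z => d z.1 z.2) hdc 1 fun z => by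
      rw [Real.norm_eq_abs, abs_of_nonneg (hd0 _ _)]
      exact hd1 _ _
  have hcont : Continuous fun γ : ProbabilityMeasure (α × α) => ∫ z, D z ∂(γ : Measure (α × α)) :=
    ProbabilityMeasure.continuous_integral_boundedContinuousFunction D
  obtain ⟨γ, hγS, hγmin⟩ := hcomp.exists_isMinOn
    ⟨⟨μ.prod ν, inferInstance⟩, isCoupling_prod μ ν⟩ hcont.continuousOn
  refine ⟨γ, hγS, le_antisymm (le_csInf ⟨_, _, hγS, rfl⟩ ?_) (wassersteinDist_le_integral hd0 hγS)⟩
  rintro _ ⟨ρ, hρ, rfl⟩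
  have := hρ.isProbabilityMeasure
  exact hγmin (show (⟨ρ, this⟩ : ProbabilityMeasure (α × α)) ∈ S from hρ)

/-! ### The relative difference metric -/

theorem relDiff_nonneg (m n : ℕ) : 0 ≤ relDiff m n := by
  unfold relDiff
  positivity

theorem relDiff_symm (m n : ℕ) : relDiff m n = relDiff n m := by
  unfold relDiff
  rw [abs_sub_comm, max_comm]

theorem relDiff_of_le {m n : ℕ} (h : m ≤ n) : relDiff m n = ((n : ℝ) - m) / n := by
  have h' : (m : ℝ) ≤ n := by exact_mod_cast h
  unfold relDiff
  rw [max_eq_right h', abs_sub_comm, abs_of_nonneg (by linarith)]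

theorem relDiff_le_one (m n : ℕ) : relDiff m n ≤ 1 := by
  unfold relDiff
  refine div_le_one_of_le₀ ?_ (by positivity)
  have hm : (0 : ℝ) ≤ m := by positivity
  have hn : (0 : ℝ) ≤ n := by positivity
  rw [abs_le]
  constructor <;> linarith [le_max_left (m : ℝ) n, le_max_right (m : ℝ) n]

theorem relDiff_zero_left {n : ℕ} (hn : 0 < n) : relDiff 0 n = 1 := by
  have : (n : ℝ) ≠ 0 := by positivity
  rw [relDiff_of_le (Nat.zero_le n)]
  simp [this]

theorem relDiff_mono_left {k m n : ℕ} (h1 : k ≤ m) (h2 : m ≤ n) : relDiff m n ≤ relDiff k n := by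
  rw [relDiff_of_le h2, relDiff_of_le (h1.trans h2)]
  gcongr

theorem relDiff_mono_right {k m n : ℕ} (h1 : k ≤ m) (h2 : m ≤ n) : relDiff k m ≤ relDiff k n := by
  rw [relDiff_of_le h1, relDiff_of_le (h1.trans h2)]
  rcases Nat.eq_zero_or_pos m with rfl | hm
  · simp only [CharP.cast_eq_zero, zero_sub, div_zero]
    have : (k : ℝ) ≤ n := by exact_mod_cast h1.trans h2
    exact div_nonneg (by linarith) (by positivity)
  · have hm' : (0 : ℝ) < m := by exact_mod_cast hm
    have hn' : (0 : ℝ) < n := by exact_mod_cast hm.trans_le h2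
    have h2' : (m : ℝ) ≤ n := by exact_mod_cast h2
    rw [div_le_div_iff₀ hm' hn']
    nlinarith [(Nat.cast_nonneg k : (0 : ℝ) ≤ k)]

/-- For `k ≤ n`, a middle point outside `[k, n]` is handled by monotonicity. Inside, with `0 < m`,
the inequality `1 - k/n ≤ (1 - k/m) + (1 - m/n)` reduces to `(m - k) * (n - m) ≥ 0`. -/
theorem relDiff_triangle (k m n : ℕ) : relDiff k n ≤ relDiff k m + relDiff m n := by
  wlog h : k ≤ n generalizing k n
  · have := this n k (le_of_not_ge h)
    rw [relDiff_symm k n, relDiff_symm k m, relDiff_symm m n]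
    linarith
  rcases le_total m k with hmk | hkm
  · linarith [relDiff_mono_left hmk h, relDiff_nonneg k m]
  rcases le_total m n with hmn | hnm
  · rw [relDiff_of_le h, relDiff_of_le hkm, relDiff_of_le hmn]
    rcases Nat.eq_zero_or_pos m with rfl | hm
    · obtain rfl : k = 0 := by omega
      simp
    · have hm' : (0 : ℝ) < m := by exact_mod_cast hm
      have hn' : (0 : ℝ) < n := by exact_mod_cast hm.trans_le hmn
      have hkm' : (k : ℝ) ≤ m := by exact_mod_cast hkm
      have hmn' : (m : ℝ) ≤ n := by exact_mod_cast hmn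
      rw [div_add_div _ _ hm'.ne' hn'.ne', div_le_div_iff₀ hn' (by positivity)]
      nlinarith [mul_nonneg (mul_nonneg (sub_nonneg.2 hkm') (sub_nonneg.2 hmn')) hn'.le]
  · linarith [relDiff_mono_right h hnm, relDiff_nonneg m n]

/-- Approximate Kantorovich-Rubinstein duality on `ℕ` with the relative difference metric. -/

theorem exists_lipschitz_wassersteinDist_relDiff_lt (μ ν : Measure ℕ) [IsProbabilityMeasure μ]
    [IsProbabilityMeasure ν] {ε : ℝ} (hε : 0 < ε) :
    ∃ h : ℕ → ℝ, (∀ x, 0 ≤ h x ∧ h x ≤ 1) ∧ (∀ x y, |h x - h y| ≤ relDiff x y) ∧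
      wassersteinDist relDiff μ ν < ∫ x, h x ∂μ - ∫ x, h x ∂ν + 5 * ε := by
  have htail : ∀ (ρ : Measure ℕ) [IsProbabilityMeasure ρ],
      ∀ᶠ k in Filter.atTop, ρ.real (Set.Ici k) ≤ ε := by
    intro ρ _
    have h1 : Filter.Tendsto (fun k => ρ (Set.Ici k)) Filter.atTop (nhds 0) := by
      have h2 := tendsto_measure_iInter_atTop (μ := ρ) (s := fun k : ℕ => Set.Ici k)
        (fun k => (Set.to_countable _).measurableSet.nullMeasurableSet)
        (fun a b hab => Set.Ici_subset_Ici.2 hab) ⟨0, measure_ne_top _ _⟩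
      have h3 : ⋂ k : ℕ, Set.Ici k = ∅ := by
        ext x
        simp only [Set.mem_iInter, Set.mem_Ici, Set.mem_empty_iff_false, iff_false, not_forall]
        exact ⟨x + 1, by omega⟩
      rwa [h3, measure_empty] at h2
    have h4 := (ENNReal.tendsto_toReal ENNReal.zero_ne_top).comp h1
    exact (h4.eventually_lt_const (by simpa using hε)).mono fun k hk => hk.le
  obtain ⟨k, hk1, hk2⟩ := ((htail μ).and (htail ν)).exists
  -- Truncation at `k` is exact below `k` and costs at most one on the tail, whose mass is at most
  -- `ε`.
  let c : Fin (k + 1) → ℕ := fun i => i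
  let g : ℕ → Fin (k + 1) := fun n => ⟨min n k, by omega⟩
  have hcost : ∀ (ρ : Measure ℕ) [IsProbabilityMeasure ρ], ρ.real (Set.Ici k) ≤ ε →
      ∫ x, relDiff x (c (g x)) ∂ρ ≤ ε := by
    intro ρ _ hρ
    refine le_trans ?_ hρ
    rw [← integral_indicator_one (Set.to_countable _).measurableSet]
    refine integral_mono ?_ ?_ ?_
    · exact Integrable.of_bound (measurable_of_countable _).aestronglyMeasurable 1
        (Filter.Eventually.of_forall fun n => by
          rw [Real.norm_eq_abs, abs_of_nonneg (relDiff_nonneg _ _)]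
          exact relDiff_le_one _ _)
    · exact (integrable_const (1 : ℝ)).indicator (Set.to_countable _).measurableSet
    · intro n
      by_cases hn : k ≤ n
      · simpa [Set.indicator, hn] using relDiff_le_one _ _
      · have : min n k = n := by omega
        simp [Set.indicator, hn, c, g, this, relDiff]
  obtain ⟨h, _, h1, h2, h3⟩ := exists_lipschitz_wassersteinDist_lt relDiff
    (measurable_of_countable _) relDiff_nonneg relDiff_le_one relDiff_symm relDiff_triangle
    μ ν g (fun i => (Set.to_countable _).measurableSet) c hε (hcost μ hk1) (hcost ν hk2)
  exact ⟨h, h1, h2, h3⟩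

/-! ### Quantization of a compact metric space -/

/-- By compactness finitely many `ε`-balls around a dense sequence cover `X`; the nearest point in
an initial segment containing their centres is a measurable choice. -/
theorem exists_finite_quantization (X : Type*) [PseudoMetricSpace X] [CompactSpace X] [Nonempty X]
    [MeasurableSpace X] [OpensMeasurableSpace X] {ε : ℝ} (hε : 0 < ε) :
    ∃ (k : ℕ) (c : Fin k → X) (g : X → Fin k),
      Measurable g ∧ ∀ x, dist x (c (g x)) ≤ ε := by
  let e := TopologicalSpace.denseSeq X
  obtain ⟨t, ht⟩ := isCompact_univ.elim_finite_subcover (fun k => Metric.ball (e k) ε)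
    (fun _ => Metric.isOpen_ball) (fun x _ => by
      obtain ⟨k, hk⟩ := (TopologicalSpace.denseRange_denseSeq X).exists_dist_lt x hε
      exact Set.mem_iUnion.2 ⟨k, hk⟩)
  let N := t.sup id
  let g : X → Fin (N + 1) :=
    fun x => ⟨SimpleFunc.nearestPtInd e N x, Nat.lt_succ_of_le (SimpleFunc.nearestPtInd_le e N x)⟩
  refine ⟨N + 1, fun i => e i, g, measurable_to_countable' fun i => ?_, fun x => ?_⟩
  · convert (SimpleFunc.nearestPtInd e N).measurableSet_preimage {(i : ℕ)} using 1
    ext x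
    simp [g, Fin.ext_iff]
  · obtain ⟨k, hkt, hk⟩ := Set.mem_iUnion₂.1 (ht (Set.mem_univ x))
    have h1 := SimpleFunc.edist_nearestPt_le e x (show k ≤ N from Finset.le_sup (f := id) hkt)
    rw [edist_dist, edist_dist, ENNReal.ofReal_le_ofReal_iff dist_nonneg, dist_comm] at h1
    rw [Metric.mem_ball, dist_comm] at hk
    exact h1.trans hk.le

/-- Approximate Kantorovich-Rubinstein duality on a compact metric space. -/

theorem exists_lipschitz_wassersteinDist_dist_lt {X : Type*} [MetricSpace X] [CompactSpace X]
    [MeasurableSpace X] [BorelSpace X] (hd : ∀ x y : X, dist x y ≤ 1) (μ ν : Measure X)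
    [IsProbabilityMeasure μ] [IsProbabilityMeasure ν] {ε : ℝ} (hε : 0 < ε) :
    ∃ h : X → ℝ, Measurable h ∧ (∀ x, 0 ≤ h x ∧ h x ≤ 1) ∧ (∀ x y, |h x - h y| ≤ dist x y) ∧
      wassersteinDist dist μ ν < ∫ x, h x ∂μ - ∫ x, h x ∂ν + 5 * ε := by
  have : Nonempty X := nonempty_of_isProbabilityMeasure μ
  obtain ⟨k, c, g, hg, hgc⟩ := exists_finite_quantization X hε
  have hcost : ∀ (ρ : Measure X) [IsProbabilityMeasure ρ],
      ∫ x, dist x (c (g x)) ∂ρ ≤ ε := by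
    intro ρ _
    calc ∫ x, dist x (c (g x)) ∂ρ ≤ ∫ _, ε ∂ρ :=
          integral_mono_of_nonneg (Filter.Eventually.of_forall fun _ => dist_nonneg)
            (integrable_const _) (Filter.Eventually.of_forall hgc)
      _ = ε := by simp
  exact exists_lipschitz_wassersteinDist_lt dist measurable_dist (fun _ _ => dist_nonneg) hd
    dist_comm dist_triangle μ ν g (fun i => hg (measurableSet_singleton i)) c hε (hcost μ) (hcost ν)

/-! ### Enumerations and matchings -/

theorem pointMeasureOf_points {X : Type*} [MeasurableSpace X] (ξ : PointMeasure X) :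
    pointMeasureOf ξ.points = ξ :=
  Subtype.ext ξ.eq_sum_points.symm

theorem exists_equiv_points_pointMeasureOf {X : Type*} [MeasurableSpace X]
    [MeasurableSingletonClass X] {n : ℕ} (x : Fin n → X) :
    ∃ e : Fin n ≃ Fin (pointMeasureOf x).card, ∀ i, (pointMeasureOf x).points (e i) = x i :=
  exists_equiv_of_sum_dirac_eq _ _ (pointMeasureOf x).eq_sum_points

theorem card_pointMeasureOf {X : Type*} [MeasurableSpace X] [MeasurableSingletonClass X] {n : ℕ}
    (x : Fin n → X) : (pointMeasureOf x).card = n := by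
  obtain ⟨e, -⟩ := exists_equiv_points_pointMeasureOf x
  exact (Fin.equiv_iff_eq.1 ⟨e⟩).symm

theorem tupleMatchDist_le {X : Type*} [PseudoMetricSpace X] {m n : ℕ} (h : m ≤ n)
    (x : Fin m → X) (y : Fin n → X) (π : Equiv.Perm (Fin n)) :
    tupleMatchDist h x y
      ≤ (∑ i : Fin m, dist (x i) (y (π (Fin.castLE h i))) + ((n : ℝ) - m)) / n := by
  unfold tupleMatchDist
  gcongr
  exact ciInf_le (Set.finite_range _).bddBelow π

theorem le_tupleMatchDist {X : Type*} [PseudoMetricSpace X] {m n : ℕ} (h : m ≤ n)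
    (x : Fin m → X) (y : Fin n → X) {r : ℝ}
    (hr : ∀ π : Equiv.Perm (Fin n),
      r ≤ (∑ i : Fin m, dist (x i) (y (π (Fin.castLE h i))) + ((n : ℝ) - m)) / n) :
    r ≤ tupleMatchDist h x y := by
  obtain ⟨π, hπ⟩ := exists_eq_ciInf_of_finite
    (f := fun π : Equiv.Perm (Fin n) => ∑ i : Fin m, dist (x i) (y (π (Fin.castLE h i))))
  unfold tupleMatchDist
  rw [← hπ]
  exact hr π

theorem dOneBar_pointMeasureOf_comp_le {X : Type*} [PseudoMetricSpace X] [MeasurableSpace X]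
    [MeasurableSingletonClass X] {n : ℕ} (x y : Fin n → X) {ε : ℝ} (hε : 0 ≤ ε)
    (h : ∀ i, dist (x i) (y i) ≤ ε) : dOneBar (pointMeasureOf x) (pointMeasureOf y) ≤ ε := by
  rw [(dOneBar_pointMeasureOf le_rfl x y).1]
  refine (tupleMatchDist_le le_rfl x y 1).trans ?_
  rw [sub_self, add_zero]
  refine div_le_of_le_mul₀ (by positivity) hε ?_
  calc _ ≤ ∑ _i : Fin n, ε := Finset.sum_le_sum fun i _ => h i
    _ = ε * n := by simp [mul_comm]

theorem pointMeasureOf_apply {X : Type*} [MeasurableSpace X] {n : ℕ} (x : Fin n → X) {A : Set X}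
    (hA : MeasurableSet A) [DecidablePred (· ∈ A)] :
    (pointMeasureOf x).1 A = (Finset.univ.filter fun i => x i ∈ A).card := by
  simp only [pointMeasureOf]
  rw [Measure.finsetSum_apply, Finset.card_filter]
  push_cast
  refine Finset.sum_congr rfl fun i _ => ?_
  rw [Measure.dirac_apply' _ hA]
  simp [Set.indicator_apply]

theorem sum_dirac_comp {X : Type*} [MeasurableSpace X] {n k : ℕ} (g : Fin n → Fin k)
    (c : Fin k → X) :
    ∑ j, Measure.dirac (c (g j))
      = ∑ i, (Finset.univ.filter fun j => g j = i).card • Measure.dirac (c i) := by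
  rw [← Finset.sum_fiberwise Finset.univ g]
  refine Finset.sum_congr rfl fun i _ => ?_
  rw [← Finset.sum_const]
  refine Finset.sum_congr rfl fun j hj => ?_
  rw [(Finset.mem_filter.1 hj).2]

/-! ### Measurability of the admissible functions -/

/-- A function of the quantized configuration depends measurably on the configuration, since it
is a function of finitely many point counts. -/

theorem measurable_comp_quantization {X : Type*} [MeasurableSpace X] {k : ℕ} (c : Fin k → X)
    (g : X → Fin k) (hg : Measurable g) (f : PointMeasure X → ℝ) :
    Measurable fun ξ : PointMeasure X => f (pointMeasureOf fun i => c (g (ξ.points i))) := by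
  classical
  -- The counts are read as natural numbers, so that `q` takes values in a countable space, on which
  -- every function is measurable.
  let q : PointMeasure X → Fin k → ℕ := fun ξ i => ⌊(ξ.1 (g ⁻¹' {i})).toReal⌋₊
  have hgi : ∀ i, MeasurableSet (g ⁻¹' {i}) := fun i => hg (measurableSet_singleton i)
  have hq : Measurable q := measurable_pi_lambda _ fun i =>
    Nat.measurable_floor.comp
      ((Measure.measurable_coe (hgi i)).comp measurable_subtype_coe).ennreal_toReal
  have hqv : ∀ ξ i, q ξ i = (Finset.univ.filter fun j => g (ξ.points j) = i).card := by
    intro ξ i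
    have h1 := pointMeasureOf_apply ξ.points (hgi i)
    rw [pointMeasureOf_points] at h1
    simp only [q, h1, ENNReal.toReal_natCast, Nat.floor_natCast]
    congr 1
    ext j
    simp
  have hfac : Function.FactorsThrough
      (fun ξ : PointMeasure X => f (pointMeasureOf fun i => c (g (ξ.points i)))) q := by
    intro ξ η h
    have h1 : (pointMeasureOf fun i => c (g (ξ.points i)))
        = pointMeasureOf fun i => c (g (η.points i)) := by
      refine Subtype.ext ?_
      simp only [pointMeasureOf]
      rw [sum_dirac_comp (fun i => g (ξ.points i)) c, sum_dirac_comp (fun i => g (η.points i)) c]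
      refine Finset.sum_congr rfl fun i _ => ?_
      rw [← hqv ξ i, ← hqv η i, h]
    simp only [h1]
  rw [← hfac.extend_comp (fun _ => 0)]
  exact (measurable_of_countable _).comp hq

/-- Moving every point by at most `1 / (n + 1)` changes `f` by at most as much, so `f` is the
pointwise limit of its quantized versions. -/
theorem measurable_of_mem_dOneBarLipschitz {X : Type*} [MetricSpace X] [CompactSpace X]
    [MeasurableSpace X] [BorelSpace X] [Nonempty X] {f : PointMeasure X → ℝ}
    (hf : f ∈ dOneBarLipschitz X) : Measurable f := by
  have hpos : ∀ n : ℕ, (0 : ℝ) < 1 / ((n : ℝ) + 1) := fun n => by positivity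
  choose k c g hg hgc using fun n : ℕ => exists_finite_quantization X (hpos n)
  refine measurable_of_tendsto_metrizable
    (fun n => measurable_comp_quantization (c n) (g n) (hg n) f) ?_
  rw [tendsto_pi_nhds]
  intro ξ
  refine tendsto_iff_dist_tendsto_zero.2
    (squeeze_zero (fun _ => dist_nonneg) (fun n => ?_) tendsto_one_div_add_atTop_nhds_zero_nat)
  rw [dist_comm, Real.dist_eq]
  refine (hf.2 _ _).trans ?_
  have h1 := dOneBar_pointMeasureOf_comp_le ξ.points (fun i => c n (g n (ξ.points i)))
    (hpos n).le fun i => hgc n _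
  rwa [pointMeasureOf_points] at h1

theorem measurable_pointMeasureOf {X : Type*} [MeasurableSpace X] (n : ℕ) :
    Measurable (pointMeasureOf : (Fin n → X) → PointMeasure X) := by
  refine Measurable.subtype_mk (Measure.measurable_of_measurable_coe _ fun A hA => ?_)
  simp only [Measure.finsetSum_apply, Measure.dirac_apply' _ hA]
  exact Finset.measurable_sum _ fun i _ =>
    (measurable_const.indicator hA).comp (measurable_pi_apply i)

theorem measurable_pointMeasureOf_prod {X : Type*} [MeasurableSpace X] :
    Measurable fun p : (ℕ → X) × ℕ => pointMeasureOf fun i : Fin p.2 => p.1 i :=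
  measurable_from_prod_countable_left fun n =>
    (measurable_pointMeasureOf n).comp
      (measurable_pi_lambda _ fun _ => measurable_pi_apply _)

/-! ### Laws of mixed binomial processes and their comparison -/

/-- The law of the first `m` of `n` independent copies. -/

theorem map_pi_castLE {X : Type*} [MeasurableSpace X] (μ : Measure X) [IsProbabilityMeasure μ]
    {m n : ℕ} (h : m ≤ n) :
    (Measure.pi fun _ : Fin n => μ).map (fun x i => x (Fin.castLE h i))
      = Measure.pi fun _ : Fin m => μ := by
  have h1 : iIndepFun (fun (i : Fin n) (x : Fin n → X) => x i) (Measure.pi fun _ : Fin n => μ) :=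
    iIndepFun_pi (X := fun _ x => x) fun _ => aemeasurable_id
  have h2 := h1.precomp (Fin.castLE_injective h)
  rw [iIndepFun_iff_map_fun_eq_pi_map fun _ => (measurable_pi_apply _).aemeasurable] at h2
  refine h2.trans ?_
  congr 1
  ext1 i
  exact (measurePreserving_eval (fun _ : Fin n => μ) (Fin.castLE h i)).map_eq

/-- The integral of a function of a mixed binomial process, conditionally on the number of
points. -/

theorem integral_map_pointProcessOf {X : Type*} [MeasurableSpace X] {Ω : Type*}
    [MeasurableSpace Ω] (P : Measure Ω) [IsProbabilityMeasure P] {M : Ω → ℕ} (hM : Measurable M)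
    {U : ℕ → Ω → X} (hU : ∀ i, Measurable (U i)) (hU_indep : iIndepFun U P)
    (hU_ident : ∀ i, IdentDistrib (U i) (U 0) P P) (hUM : IndepFun (fun ω i => U i ω) M P)
    {f : PointMeasure X → ℝ} (hf : Measurable f) {C : ℝ} (hC : ∀ ξ, |f ξ| ≤ C) :
    ∫ ξ, f ξ ∂(P.map (pointProcessOf M U))
      = ∫ m, (∫ x, f (pointMeasureOf x) ∂(Measure.pi fun _ : Fin m => P.map (U 0))) ∂(P.map M) := by
  have hUm : Measurable fun ω i => U i ω := measurable_pi_lambda _ hU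
  have hpair : Measurable fun ω => ((fun i => U i ω), M ω) := hUm.prodMk hM
  have hΦ := hf.comp (measurable_pointMeasureOf_prod (X := X))
  have hΞ : Measurable (pointProcessOf M U) := measurable_pointMeasureOf_prod.comp hpair
  have := Measure.isProbabilityMeasure_map (μ := P) hUm.aemeasurable
  have := Measure.isProbabilityMeasure_map (μ := P) hM.aemeasurable
  have := Measure.isProbabilityMeasure_map (μ := P) (hU 0).aemeasurable
  rw [integral_map hΞ.aemeasurable hf.aestronglyMeasurable]
  calc ∫ ω, f (pointProcessOf M U ω) ∂P
      = ∫ p : (ℕ → X) × ℕ, f (pointMeasureOf fun i : Fin p.2 => p.1 i)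
          ∂(P.map fun ω => ((fun i => U i ω), M ω)) :=
        (integral_map hpair.aemeasurable hΦ.aestronglyMeasurable).symm
    _ = ∫ p : (ℕ → X) × ℕ, f (pointMeasureOf fun i : Fin p.2 => p.1 i)
          ∂((P.map fun ω i => U i ω).prod (P.map M)) := by
        rw [(indepFun_iff_map_prod_eq_prod_map_map hUm.aemeasurable hM.aemeasurable).1 hUM]
    _ = ∫ m, ∫ u, f (pointMeasureOf fun i : Fin m => u i) ∂(P.map fun ω i => U i ω) ∂(P.map M) :=
        integral_prod_symm _ (Integrable.of_bound hΦ.aestronglyMeasurable C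
          (Filter.Eventually.of_forall fun p => hC _))
    _ = _ := by
        refine integral_congr_ae (Filter.Eventually.of_forall fun m => ?_)
        have hr : Measurable fun (u : ℕ → X) (i : Fin m) => u i :=
          measurable_pi_lambda _ fun i => measurable_pi_apply _
        have h1 : (P.map fun ω i => U i ω).map (fun u (i : Fin m) => u i)
            = Measure.pi fun _ : Fin m => P.map (U 0) := by
          rw [Measure.map_map hr hUm]
          have h2 := hU_indep.precomp (g := fun i : Fin m => (i : ℕ)) Fin.val_injective
          rw [iIndepFun_iff_map_fun_eq_pi_map fun i => (hU _).aemeasurable] at h2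
          refine h2.trans ?_
          congr 1
          ext1 i
          exact (hU_ident i).map_eq
        dsimp only
        have hfm : Measurable fun x : Fin m → X => f (pointMeasureOf x) :=
          hf.comp (measurable_pointMeasureOf m)
        rw [← h1, integral_map hr.aemeasurable hfm.aestronglyMeasurable]

/-- Comparison of two binomial processes by means of a coupling of the point distributions. -/

theorem abs_integral_pi_sub_le {X : Type*} [MetricSpace X] [CompactSpace X] [MeasurableSpace X]
    [BorelSpace X] (hd : ∀ x y : X, dist x y ≤ 1) {μ ν : Measure X} [IsProbabilityMeasure μ]
    [IsProbabilityMeasure ν] {κ : Measure (X × X)} (hκ : IsCoupling κ μ ν)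
    {f : PointMeasure X → ℝ} (hf : f ∈ dOneBarLipschitz X) {m n : ℕ} (h : m ≤ n) :
    |∫ x, f (pointMeasureOf x) ∂(Measure.pi fun _ : Fin m => μ)
        - ∫ y, f (pointMeasureOf y) ∂(Measure.pi fun _ : Fin n => ν)|
      ≤ relDiff m n + (m : ℝ) / n * ∫ p, dist p.1 p.2 ∂κ := by
  have := hκ.isProbabilityMeasure
  have : Nonempty X := nonempty_of_isProbabilityMeasure μ
  have hfm := measurable_of_mem_dOneBarLipschitz hf
  -- Of `n` independent pairs, the shorter pattern uses the first `m` first coordinates, the longer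
  -- one all second coordinates; the identity matching bounds `dOneBar`.
  let τ : Measure (Fin n → X × X) := Measure.pi fun _ => κ
  have hX1 : Measurable fun (z : Fin n → X × X) (i : Fin m) => (z (Fin.castLE h i)).1 := by fun_prop
  have hY1 : Measurable fun (z : Fin n → X × X) (i : Fin n) => (z i).2 := by fun_prop
  have hμ : τ.map (fun z (i : Fin m) => (z (Fin.castLE h i)).1) = Measure.pi fun _ : Fin m => μ := by
    rw [← map_pi_castLE μ h]
    have h1 : τ.map (fun z i => (z i).1) = Measure.pi fun _ : Fin n => μ := by
      simp only [τ, ← hκ.1]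
      have : IsProbabilityMeasure (κ.map Prod.fst) := by rw [hκ.1]; infer_instance
      exact Measure.pi_map_pi fun _ => measurable_fst.aemeasurable
    rw [← h1, Measure.map_map (by fun_prop) (by fun_prop)]
    rfl
  have hν : τ.map (fun z i => (z i).2) = Measure.pi fun _ : Fin n => ν := by
    simp only [τ, ← hκ.2]
    have : IsProbabilityMeasure (κ.map Prod.snd) := by rw [hκ.2]; infer_instance
    exact Measure.pi_map_pi fun _ => measurable_snd.aemeasurable
  have hF : ∀ k, Measurable fun x : Fin k → X => f (pointMeasureOf x) := fun k =>
    hfm.comp (measurable_pointMeasureOf k)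
  have hint : ∀ {β : Type _} [MeasurableSpace β] (ρ : Measure β) [IsProbabilityMeasure ρ]
      (F : β → PointMeasure X), Measurable F → Integrable (fun z => f (F z)) ρ := by
    intro β _ ρ _ F hFm
    refine Integrable.of_bound (hfm.comp hFm).aestronglyMeasurable 1
      (Filter.Eventually.of_forall fun z => ?_)
    rw [Real.norm_eq_abs, abs_of_nonneg (hf.1 _).1]
    exact (hf.1 _).2
  have hdint : ∀ {β : Type _} [MeasurableSpace β] (ρ : Measure β) [IsProbabilityMeasure ρ]
      (F : β → X × X), Measurable F → Integrable (fun z => dist (F z).1 (F z).2) ρ := by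
    intro β _ ρ _ F hFm
    refine Integrable.of_bound (measurable_dist.comp hFm).aestronglyMeasurable 1
      (Filter.Eventually.of_forall fun z => ?_)
    rw [Real.norm_eq_abs, abs_of_nonneg dist_nonneg]
    exact hd _ _
  rw [← hμ, ← hν, integral_map hX1.aemeasurable (hF m).aestronglyMeasurable,
    integral_map hY1.aemeasurable (hF n).aestronglyMeasurable,
    ← integral_sub
      (hint τ (fun z => pointMeasureOf fun i : Fin m => (z (Fin.castLE h i)).1)
        ((measurable_pointMeasureOf m).comp hX1))
      (hint τ (fun z => pointMeasureOf fun i => (z i).2) ((measurable_pointMeasureOf n).comp hY1))]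
  have hdi : ∀ i : Fin n, Integrable (fun z : Fin n → X × X => dist (z i).1 (z i).2) τ :=
    fun i => hdint τ (fun z => z i) (measurable_pi_apply i)
  have hsumint : Integrable (fun z : Fin n → X × X =>
      ∑ i : Fin m, dist (z (Fin.castLE h i)).1 (z (Fin.castLE h i)).2) τ :=
    integrable_finsetSum _ fun i _ => hdi _
  calc _ ≤ ∫ z, |f (pointMeasureOf fun i : Fin m => (z (Fin.castLE h i)).1)
            - f (pointMeasureOf fun i => (z i).2)| ∂τ := abs_integral_le_integral_abs
    _ ≤ ∫ z, (∑ i : Fin m, dist (z (Fin.castLE h i)).1 (z (Fin.castLE h i)).2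
          + ((n : ℝ) - m)) / n ∂τ := by
        refine integral_mono_of_nonneg (Filter.Eventually.of_forall fun _ => abs_nonneg _)
          ((hsumint.add (integrable_const _)).div_const _) (Filter.Eventually.of_forall fun z => ?_)
        refine (hf.2 _ _).trans ?_
        rw [(dOneBar_pointMeasureOf h _ _).1]
        exact tupleMatchDist_le h _ _ 1
    _ = (∑ i : Fin m, ∫ p, dist p.1 p.2 ∂κ + ((n : ℝ) - m)) / n := by
        rw [integral_div, integral_add hsumint (integrable_const _),
          integral_finsetSum _ fun i _ => hdi _]
        simp only [integral_const, probReal_univ, one_smul]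
        congr 2
        refine Finset.sum_congr rfl fun i _ => ?_
        have h1 := measurePreserving_eval (fun _ : Fin n => κ) (Fin.castLE h i)
        rw [← h1.map_eq, integral_map h1.measurable.aemeasurable
          measurable_dist.aestronglyMeasurable]
    _ = _ := by
        rw [relDiff_of_le h]
        simp only [Finset.sum_const, Finset.card_univ, Fintype.card_fin, nsmul_eq_mul]
        ring

/-! ### Test functions for the lower bounds -/

theorem dOneBar_comm {X : Type*} [PseudoMetricSpace X] [MeasurableSpace X]
    [MeasurableSingletonClass X] (ξ η : PointMeasure X) : dOneBar ξ η = dOneBar η ξ := by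
  wlog h : ξ.card ≤ η.card generalizing ξ η
  · exact (this η ξ (le_of_not_ge h)).symm
  · have h1 := dOneBar_pointMeasureOf h ξ.points η.points
    rw [pointMeasureOf_points, pointMeasureOf_points] at h1
    rw [h1.1, h1.2]

theorem dOneBar_of_card_le {X : Type*} [PseudoMetricSpace X] [MeasurableSpace X]
    {ξ η : PointMeasure X} (h : ξ.card ≤ η.card) :
    dOneBar ξ η = tupleMatchDist h ξ.points η.points := by
  unfold dOneBar
  rw [dif_pos h]

theorem relDiff_card_le_dOneBar {X : Type*} [PseudoMetricSpace X] [MeasurableSpace X]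
    [MeasurableSingletonClass X] (ξ η : PointMeasure X) :
    relDiff ξ.card η.card ≤ dOneBar ξ η := by
  wlog h : ξ.card ≤ η.card generalizing ξ η
  · rw [relDiff_symm, dOneBar_comm]
    exact this η ξ (le_of_not_ge h)
  rw [dOneBar_of_card_le h, relDiff_of_le h]
  refine le_tupleMatchDist h _ _ fun π => ?_
  gcongr
  have : (0 : ℝ) ≤ ∑ i : Fin ξ.card, dist (ξ.points i) (η.points (π (Fin.castLE h i))) :=
    Finset.sum_nonneg fun _ _ => dist_nonneg
  linarith

theorem comp_card_mem_dOneBarLipschitz {X : Type*} [PseudoMetricSpace X] [MeasurableSpace X]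
    [MeasurableSingletonClass X] {h : ℕ → ℝ} (h01 : ∀ n, 0 ≤ h n ∧ h n ≤ 1)
    (hlip : ∀ m n, |h m - h n| ≤ relDiff m n) :
    (fun ξ : PointMeasure X => h ξ.card) ∈ dOneBarLipschitz X :=
  ⟨fun _ => h01 _, fun ξ η => (hlip _ _).trans (relDiff_card_le_dOneBar ξ η)⟩

/-- The average of `g` over the points of a point measure, with value `a` at the zero measure. -/
noncomputable def pointAverage {X : Type*} [MeasurableSpace X] (g : X → ℝ) (a : ℝ)
    (ξ : PointMeasure X) : ℝ :=
  if ξ.card = 0 then a else (∑ i, g (ξ.points i)) / ξ.card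

theorem pointAverage_pointMeasureOf {X : Type*} [MeasurableSpace X] [MeasurableSingletonClass X]
    (g : X → ℝ) (a : ℝ) {n : ℕ} (x : Fin n → X) :
    pointAverage g a (pointMeasureOf x) = if n = 0 then a else (∑ i, g (x i)) / n := by
  obtain ⟨e, he⟩ := exists_equiv_points_pointMeasureOf x
  unfold pointAverage
  rw [← e.sum_comp]
  simp only [he, card_pointMeasureOf]

theorem sum_castLE_le_sum_le {m n : ℕ} (h : m ≤ n) (b : Fin n → ℝ) (hb : ∀ i, 0 ≤ b i ∧ b i ≤ 1) :
    ∑ i : Fin m, b (Fin.castLE h i) ≤ ∑ j, b j ∧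
      ∑ j, b j ≤ ∑ i : Fin m, b (Fin.castLE h i) + ((n : ℝ) - m) := by
  obtain ⟨k, rfl⟩ := Nat.exists_eq_add_of_le h
  rw [Fin.sum_univ_add]
  have h1 : 0 ≤ ∑ i : Fin k, b (Fin.natAdd m i) := Finset.sum_nonneg fun i _ => (hb _).1
  have h2 : ∑ i : Fin k, b (Fin.natAdd m i) ≤ ∑ _i : Fin k, (1 : ℝ) :=
    Finset.sum_le_sum fun i _ => (hb _).2
  have h3 : ∑ i : Fin m, b (Fin.castLE h i) = ∑ i : Fin m, b (Fin.castAdd k i) := rfl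
  simp only [Finset.sum_const, Finset.card_univ, Fintype.card_fin, nsmul_eq_mul, mul_one] at h2
  rw [h3]
  push_cast
  constructor <;> linarith

/-- Fix a matching. Replacing `1/m` by `1/n` lowers the first average by at most `(n - m)/n`, and
the unmatched points of `y` add between `0` and `(n - m)/n` to the second. These errors act in
opposite directions, so only one of them counts in each inequality. -/
theorem abs_average_sub_average_le {X : Type*} [PseudoMetricSpace X] {g : X → ℝ}
    (hg01 : ∀ x, 0 ≤ g x ∧ g x ≤ 1) (hg : ∀ x y, |g x - g y| ≤ dist x y) {m n : ℕ} (hm : 0 < m)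
    (h : m ≤ n) (x : Fin m → X) (y : Fin n → X) :
    |(∑ i, g (x i)) / m - (∑ j, g (y j)) / n| ≤ tupleMatchDist h x y := by
  refine le_tupleMatchDist h x y fun π => ?_
  have hm' : (0 : ℝ) < m := by exact_mod_cast hm
  have hn' : (0 : ℝ) < n := by exact_mod_cast hm.trans_le h
  have hmn : (m : ℝ) ≤ n := by exact_mod_cast h
  obtain ⟨hB1, hB2⟩ := sum_castLE_le_sum_le h (fun j => g (y (π j))) fun j => hg01 _
  rw [Equiv.sum_comp π fun j => g (y j)] at hB1 hB2
  have hA0 : 0 ≤ ∑ i, g (x i) := Finset.sum_nonneg fun i _ => (hg01 _).1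
  have hAm : ∑ i, g (x i) ≤ m := by
    calc ∑ i, g (x i) ≤ ∑ _i : Fin m, (1 : ℝ) := Finset.sum_le_sum fun i _ => (hg01 _).2
      _ = m := by simp
  have hAB : |∑ i, g (x i) - ∑ i : Fin m, g (y (π (Fin.castLE h i)))|
      ≤ ∑ i : Fin m, dist (x i) (y (π (Fin.castLE h i))) := by
    rw [← Finset.sum_sub_distrib]
    exact (Finset.abs_sum_le_sum_abs _ _).trans (Finset.sum_le_sum fun i _ => hg _ _)
  set A := ∑ i, g (x i)
  set B := ∑ i : Fin m, g (y (π (Fin.castLE h i)))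
  set S := ∑ j, g (y j)
  set D := ∑ i : Fin m, dist (x i) (y (π (Fin.castLE h i)))
  obtain ⟨h1, h2⟩ := abs_le.1 hAB
  have h3 : A / n ≤ A / m := div_le_div_of_nonneg_left hA0 hm' hmn
  have h4 : A / m - A / n ≤ (n - m) / n := by
    have e : A / m - A / n = A / m * ((n - m) / n) := by field_simp
    rw [e]
    exact mul_le_of_le_one_left (div_nonneg (by linarith) hn'.le) (div_le_one_of_le₀ hAm hm'.le)
  have h5 : S / n ≤ (A + D + (n - m)) / n := by gcongr; linarith
  have h6 : (A - D) / n ≤ S / n := by gcongr; linarith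
  rw [add_div, add_div] at h5
  rw [sub_div] at h6
  rw [add_div, abs_le]
  constructor <;> linarith

/-- The zero measure is at distance at least one from every other pattern, so the value `a` is
unconstrained within `[0,1]`. -/
theorem pointAverage_mem_dOneBarLipschitz {X : Type*} [PseudoMetricSpace X] [MeasurableSpace X]
    [MeasurableSingletonClass X] {g : X → ℝ} (hg01 : ∀ x, 0 ≤ g x ∧ g x ≤ 1)
    (hg : ∀ x y, |g x - g y| ≤ dist x y) {a : ℝ} (ha : 0 ≤ a ∧ a ≤ 1) :
    pointAverage g a ∈ dOneBarLipschitz X := by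
  have h01 : ∀ ξ : PointMeasure X, 0 ≤ pointAverage g a ξ ∧ pointAverage g a ξ ≤ 1 := by
    intro ξ
    unfold pointAverage
    split_ifs with h0
    · exact ha
    · refine ⟨div_nonneg (Finset.sum_nonneg fun i _ => (hg01 _).1) (by positivity), ?_⟩
      refine div_le_one_of_le₀ ?_ (by positivity)
      calc ∑ i, g (ξ.points i) ≤ ∑ _i : Fin ξ.card, (1 : ℝ) :=
            Finset.sum_le_sum fun i _ => (hg01 _).2
        _ = ξ.card := by simp
  refine ⟨h01, fun ξ η => ?_⟩
  wlog h : ξ.card ≤ η.card generalizing ξ η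
  · rw [abs_sub_comm, dOneBar_comm]
    exact this η ξ (le_of_not_ge h)
  rcases Nat.eq_zero_or_pos η.card with hη | hη
  · have hξ : ξ.card = 0 := by omega
    have h1 := (relDiff_nonneg _ _).trans (relDiff_card_le_dOneBar ξ η)
    simpa [pointAverage, hξ, hη] using h1
  rcases Nat.eq_zero_or_pos ξ.card with hξ | hξ
  · have h1 := relDiff_card_le_dOneBar ξ η
    rw [hξ, relDiff_zero_left hη] at h1
    refine le_trans ?_ h1
    rw [abs_le]
    constructor <;> linarith [(h01 ξ).1, (h01 ξ).2, (h01 η).1, (h01 η).2]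
  · rw [dOneBar_of_card_le h]
    unfold pointAverage
    rw [if_neg hξ.ne', if_neg hη.ne']
    exact abs_average_sub_average_le hg01 hg hξ h _ _

theorem integral_pi_pointAverage {X : Type*} [MeasurableSpace X] [MeasurableSingletonClass X]
    (μ : Measure X) [IsProbabilityMeasure μ] {g : X → ℝ} (hg : Integrable g μ) (a : ℝ) (n : ℕ) :
    ∫ x, pointAverage g a (pointMeasureOf x) ∂(Measure.pi fun _ : Fin n => μ)
      = if n = 0 then a else ∫ x, g x ∂μ := by
  simp only [pointAverage_pointMeasureOf]
  split_ifs with hn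
  · simp
  · have hn' : (n : ℝ) ≠ 0 := by exact_mod_cast hn
    have hp : ∀ i : Fin n, MeasurePreserving (Function.eval i) (Measure.pi fun _ : Fin n => μ) μ :=
      fun i => measurePreserving_eval (fun _ : Fin n => μ) i
    have h1 : ∀ i : Fin n, ∫ x : Fin n → X, g (x i) ∂(Measure.pi fun _ : Fin n => μ)
        = ∫ x, g x ∂μ := by
      intro i
      have hgi := hg.aestronglyMeasurable
      rw [← (hp i).map_eq] at hgi
      conv_rhs => rw [← (hp i).map_eq]
      exact (integral_map (hp i).measurable.aemeasurable hgi).symm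
    have h2 : ∀ i : Fin n, Integrable (fun x : Fin n → X => g (x i)) (Measure.pi fun _ => μ) :=
      fun i => (hp i).integrable_comp_of_integrable hg
    rw [integral_div, integral_finsetSum _ fun i _ => h2 i]
    simp only [h1, Finset.sum_const, Finset.card_univ, Fintype.card_fin, nsmul_eq_mul]
    field_simp

/-! ### Bounds for `dTwoBar` and `cTwo` -/

theorem abs_integral_sub_le_dTwoBar {X : Type*} [PseudoMetricSpace X] [MeasurableSpace X]
    (P Q : Measure (PointMeasure X)) [IsProbabilityMeasure P] [IsProbabilityMeasure Q]
    {f : PointMeasure X → ℝ} (hf : f ∈ dOneBarLipschitz X) :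
    |∫ ξ, f ξ ∂P - ∫ ξ, f ξ ∂Q| ≤ dTwoBar P Q := by
  refine le_csSup ⟨1, ?_⟩ ⟨f, hf, rfl⟩
  rintro _ ⟨F, hF, rfl⟩
  have h : ∀ (ρ : Measure (PointMeasure X)) [IsProbabilityMeasure ρ],
      0 ≤ (∫ ξ, F ξ ∂ρ) ∧ ∫ ξ, F ξ ∂ρ ≤ 1 := by
    intro ρ _
    refine ⟨integral_nonneg fun ξ => (hF.1 ξ).1, ?_⟩
    calc ∫ ξ, F ξ ∂ρ ≤ ∫ _, (1 : ℝ) ∂ρ :=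
          integral_mono_of_nonneg (Filter.Eventually.of_forall fun ξ => (hF.1 ξ).1)
            (integrable_const _) (Filter.Eventually.of_forall fun ξ => (hF.1 ξ).2)
      _ = 1 := by simp
  have h1 := h P
  have h2 := h Q
  rw [abs_le]
  constructor <;> linarith [h1.1, h1.2, h2.1, h2.2]

theorem cTwo_integrand_eq (p : ℕ × ℕ) :
    Set.indicator {q : ℕ × ℕ | 0 < max q.1 q.2}
      (fun q => min (q.1 : ℝ) (q.2 : ℝ) / max (q.1 : ℝ) (q.2 : ℝ)) p
      = min (p.1 : ℝ) (p.2 : ℝ) / max (p.1 : ℝ) (p.2 : ℝ) := by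
  by_cases hp : 0 < max p.1 p.2
  · exact Set.indicator_of_mem (s := {q : ℕ × ℕ | 0 < max q.1 q.2}) hp _
  · rw [Set.indicator_of_notMem (s := {q : ℕ × ℕ | 0 < max q.1 q.2}) hp]
    have h1 : p.1 = 0 := by omega
    have h2 : p.2 = 0 := by omega
    simp [h1, h2]

theorem min_div_max_nonneg (m n : ℕ) : 0 ≤ min (m : ℝ) n / max (m : ℝ) n := by positivity

theorem min_div_max_le_one (m n : ℕ) : min (m : ℝ) n / max (m : ℝ) n ≤ 1 :=
  div_le_one_of_le₀ min_le_max (by positivity)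

theorem cTwo_eq_integral (γ : Measure (ℕ × ℕ)) :
    cTwo γ = ∫ p : ℕ × ℕ, min (p.1 : ℝ) (p.2 : ℝ) / max (p.1 : ℝ) (p.2 : ℝ) ∂γ := by
  unfold cTwo
  simp only [cTwo_integrand_eq]

theorem integrable_nat_of_le_one {β : Type*} [MeasurableSpace β] [Countable β]
    [MeasurableSingletonClass β] (ρ : Measure β) [IsProbabilityMeasure ρ] (F : β → ℝ)
    (hF : ∀ z, |F z| ≤ 1) : Integrable F ρ :=
  Integrable.of_bound (measurable_of_countable F).aestronglyMeasurable 1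
    (Filter.Eventually.of_forall hF)

/-- The integrand is at most one and vanishes as soon as either count is zero. -/
theorem cTwo_le_min {γ : Measure (ℕ × ℕ)} {μ ν : Measure ℕ} [IsProbabilityMeasure μ]
    (h : IsCoupling γ μ ν) : cTwo γ ≤ min (μ.real {n | 0 < n}) (ν.real {n | 0 < n}) := by
  have := h.isProbabilityMeasure
  have hm : ∀ s : Set ℕ, MeasurableSet s := fun s => s.to_countable.measurableSet
  have key : ∀ (π : ℕ × ℕ → ℕ), Measurable π →
      (∀ p, π p = 0 → min (p.1 : ℝ) (p.2 : ℝ) = 0) → cTwo γ ≤ (γ.map π).real {n | 0 < n} := by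
    intro π hπ h0
    rw [map_measureReal_apply hπ (hm _), cTwo_eq_integral,
      ← integral_indicator_one (hπ (hm _))]
    refine integral_mono (integrable_nat_of_le_one γ _ fun p => ?_)
      ((integrable_const (1 : ℝ)).indicator (hπ (hm _))) fun p => ?_
    · rw [abs_of_nonneg (min_div_max_nonneg _ _)]
      exact min_div_max_le_one _ _
    · by_cases hp : 0 < π p
      · simpa [Set.indicator, hp] using min_div_max_le_one _ _
      · simp [h0 p (by omega), Set.indicator, hp]
  refine le_min ?_ ?_
  · have := key Prod.fst measurable_fst fun p hp => by simp [hp]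
    rwa [h.1] at this
  · have := key Prod.snd measurable_snd fun p hp => by simp [hp]
    rwa [h.2] at this

theorem cTwo_nonneg (γ : Measure (ℕ × ℕ)) : 0 ≤ cTwo γ := by
  rw [cTwo_eq_integral]
  exact integral_nonneg fun p => min_div_max_nonneg _ _

theorem IsCoupling.swap {α : Type*} [MeasurableSpace α] {γ : Measure (α × α)} {μ ν : Measure α}
    (h : IsCoupling γ μ ν) : IsCoupling (γ.map Prod.swap) ν μ := by
  constructor
  · rw [Measure.map_map measurable_fst measurable_swap]
    exact h.2
  · rw [Measure.map_map measurable_snd measurable_swap]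
    exact h.1

theorem abs_integral_pi_sub_le_relDiff_add {X : Type*} [MetricSpace X] [CompactSpace X]
    [MeasurableSpace X] [BorelSpace X] (hd : ∀ x y : X, dist x y ≤ 1) {μ ν : Measure X}
    [IsProbabilityMeasure μ] [IsProbabilityMeasure ν] {κ : Measure (X × X)}
    (hκ : IsCoupling κ μ ν) {f : PointMeasure X → ℝ} (hf : f ∈ dOneBarLipschitz X) (m n : ℕ) :
    |∫ x, f (pointMeasureOf x) ∂(Measure.pi fun _ : Fin m => μ)
        - ∫ y, f (pointMeasureOf y) ∂(Measure.pi fun _ : Fin n => ν)|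
      ≤ relDiff m n + min (m : ℝ) n / max (m : ℝ) n * ∫ p, dist p.1 p.2 ∂κ := by
  rcases le_total m n with h | h
  · have h' : (m : ℝ) ≤ n := by exact_mod_cast h
    rw [min_eq_left h', max_eq_right h']
    exact abs_integral_pi_sub_le hd hκ hf h
  · have h' : (n : ℝ) ≤ m := by exact_mod_cast h
    rw [min_eq_right h', max_eq_left h', abs_sub_comm, relDiff_symm]
    have h1 := abs_integral_pi_sub_le hd hκ.swap hf h
    rw [integral_map measurable_swap.aemeasurable measurable_dist.aestronglyMeasurable] at h1
    simpa [dist_comm] using h1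

/-! ### The two-sided estimate -/

theorem proposition4 {X : Type*} [MetricSpace X] [CompactSpace X] [MeasurableSpace X]
    [BorelSpace X] (hd : ∀ x y : X, dist x y ≤ 1)
    {Ω : Type*} [MeasurableSpace Ω] (P : Measure Ω) [IsProbabilityMeasure P]
    {Ω' : Type*} [MeasurableSpace Ω'] (Q : Measure Ω') [IsProbabilityMeasure Q]
    (M : Ω → ℕ) (hM : Measurable M) (N : Ω' → ℕ) (hN : Measurable N)
    (U : ℕ → Ω → X) (hU : ∀ i, Measurable (U i)) (hU_indep : iIndepFun U P)
    (hU_ident : ∀ i, IdentDistrib (U i) (U 0) P P) (hUM : IndepFun (fun ω i => U i ω) M P)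
    (V : ℕ → Ω' → X) (hV : ∀ i, Measurable (V i)) (hV_indep : iIndepFun V Q)
    (hV_ident : ∀ i, IdentDistrib (V i) (V 0) Q Q) (hVN : IndepFun (fun ω i => V i ω) N Q) :
    max (wassersteinDist relDiff (P.map M) (Q.map N))
        (max (P.real {ω | 0 < M ω}) (Q.real {ω | 0 < N ω}) *
          wassersteinDist dist (P.map (U 0)) (Q.map (V 0)))
      ≤ dTwoBar (P.map (pointProcessOf M U)) (Q.map (pointProcessOf N V)) ∧
    (∃ γ : Measure (ℕ × ℕ), IsOptimalCoupling relDiff γ (P.map M) (Q.map N)) ∧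
    ∀ γ : Measure (ℕ × ℕ), IsOptimalCoupling relDiff γ (P.map M) (Q.map N) →
      dTwoBar (P.map (pointProcessOf M U)) (Q.map (pointProcessOf N V))
          ≤ wassersteinDist relDiff (P.map M) (Q.map N)
            + cTwo γ * wassersteinDist dist (P.map (U 0)) (Q.map (V 0)) ∧
      cTwo γ ≤ min (P.real {ω | 0 < M ω}) (Q.real {ω | 0 < N ω}) := by
  have hmeas : ∀ s : Set ℕ, MeasurableSet s := fun s => s.to_countable.measurableSet
  have hPM : P.real {ω | 0 < M ω} = (P.map M).real {n | 0 < n} :=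
    (map_measureReal_apply hM (hmeas _)).symm
  have hQN : Q.real {ω | 0 < N ω} = (Q.map N).real {n | 0 < n} :=
    (map_measureReal_apply hN (hmeas _)).symm
  have iM := Measure.isProbabilityMeasure_map (μ := P) hM.aemeasurable
  have iN := Measure.isProbabilityMeasure_map (μ := Q) hN.aemeasurable
  have iU := Measure.isProbabilityMeasure_map (μ := P) (hU 0).aemeasurable
  have iV := Measure.isProbabilityMeasure_map (μ := Q) (hV 0).aemeasurable
  have hX : Nonempty X := nonempty_of_isProbabilityMeasure (P.map (U 0))
  have hΞ : Measurable (pointProcessOf M U) :=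
    measurable_pointMeasureOf_prod.comp ((measurable_pi_lambda _ hU).prodMk hM)
  have hH : Measurable (pointProcessOf N V) :=
    measurable_pointMeasureOf_prod.comp ((measurable_pi_lambda _ hV).prodMk hN)
  have iΞ := Measure.isProbabilityMeasure_map (μ := P) hΞ.aemeasurable
  have iH := Measure.isProbabilityMeasure_map (μ := Q) hH.aemeasurable
  have hfle : ∀ f ∈ dOneBarLipschitz X, ∀ ξ, |f ξ| ≤ 1 := fun f hf ξ => by
    rw [abs_of_nonneg (hf.1 ξ).1]
    exact (hf.1 ξ).2
  have hlawΞ : ∀ f ∈ dOneBarLipschitz X, _ := fun f hf =>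
    integral_map_pointProcessOf P hM hU hU_indep hU_ident hUM
      (measurable_of_mem_dOneBarLipschitz hf) (hfle f hf)
  have hlawH : ∀ f ∈ dOneBarLipschitz X, _ := fun f hf =>
    integral_map_pointProcessOf Q hN hV hV_indep hV_ident hVN
      (measurable_of_mem_dOneBarLipschitz hf) (hfle f hf)
  refine ⟨max_le ?_ ?_, ?_, fun γ hγ => ⟨?_, ?_⟩⟩
  · refine le_of_forall_pos_le_add fun δ hδ => ?_
    obtain ⟨h, h01, hlip, hlt⟩ := exists_lipschitz_wassersteinDist_relDiff_lt (P.map M) (Q.map N)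
      (ε := δ / 5) (by positivity)
    have hmem := comp_card_mem_dOneBarLipschitz (X := X) h01 hlip
    have h1 := abs_integral_sub_le_dTwoBar (P.map (pointProcessOf M U))
      (Q.map (pointProcessOf N V)) hmem
    rw [hlawΞ _ hmem, hlawH _ hmem] at h1
    simp only [card_pointMeasureOf, integral_const, probReal_univ, one_smul] at h1
    linarith [le_abs_self (∫ m, h m ∂(P.map M) - ∫ n, h n ∂(Q.map N))]
  · rw [hPM, hQN]
    refine le_of_forall_pos_le_add fun δ hδ => ?_
    obtain ⟨g, hgm, hg01, hlip, hlt⟩ := exists_lipschitz_wassersteinDist_dist_lt hd (P.map (U 0))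
      (Q.map (V 0)) (ε := δ / 5) (by positivity)
    have hgint : ∀ (ρ : Measure X) [IsProbabilityMeasure ρ], Integrable g ρ := fun ρ _ =>
      Integrable.of_bound hgm.aestronglyMeasurable 1 (Filter.Eventually.of_forall fun x => by
        rw [Real.norm_eq_abs, abs_of_nonneg (hg01 x).1]
        exact (hg01 x).2)
    have hgint01 : ∀ (ρ : Measure X) [IsProbabilityMeasure ρ],
        0 ≤ (∫ x, g x ∂ρ) ∧ ∫ x, g x ∂ρ ≤ 1 := by
      intro ρ _
      refine ⟨integral_nonneg fun x => (hg01 x).1, ?_⟩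
      calc ∫ x, g x ∂ρ ≤ ∫ _, (1 : ℝ) ∂ρ :=
            integral_mono (hgint ρ) (integrable_const _) fun x => (hg01 x).2
        _ = 1 := by simp
    -- Given `m > 0` points, the average has mean `I` whatever `m` is, so only the event of no
    -- points matters.
    have hmix : ∀ (ρ : Measure ℕ) [IsProbabilityMeasure ρ] (a I : ℝ),
        ∫ m, (if m = 0 then a else I) ∂ρ = a + ρ.real {n | 0 < n} * (I - a) := by
      intro ρ _ a I
      have e : ∀ m : ℕ, (if m = 0 then a else I)
          = a + Set.indicator {n : ℕ | 0 < n} (fun _ => I - a) m := by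
        intro m
        rcases Nat.eq_zero_or_pos m with rfl | hm
        · simp
        · simp [Set.indicator, hm, hm.ne']
      simp only [e]
      rw [integral_add (integrable_const _) ((integrable_const _).indicator (hmeas _)),
        integral_indicator_const _ (hmeas _)]
      simp
    have hlow : ∀ a : ℝ, 0 ≤ a ∧ a ≤ 1 →
        (P.map M).real {n | 0 < n} * (∫ x, g x ∂(P.map (U 0)) - a)
          - (Q.map N).real {n | 0 < n} * (∫ x, g x ∂(Q.map (V 0)) - a)
          ≤ dTwoBar (P.map (pointProcessOf M U)) (Q.map (pointProcessOf N V)) := by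
      intro a ha
      have hmem := pointAverage_mem_dOneBarLipschitz hg01 hlip ha
      have h1 := abs_integral_sub_le_dTwoBar (P.map (pointProcessOf M U))
        (Q.map (pointProcessOf N V)) hmem
      rw [hlawΞ _ hmem, hlawH _ hmem] at h1
      simp only [integral_pi_pointAverage _ (hgint _), hmix] at h1
      have h2 := (le_abs_self _).trans h1
      linarith
    -- Taking `a` to be the mean of `g` under one point law cancels that law's term and leaves the
    -- difference of means times the other law's probability of having points.
    have hP1 := hlow _ (hgint01 (Q.map (V 0)))
    have hQ1 := hlow _ (hgint01 (P.map (U 0)))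
    have hbound : ∀ p : ℝ, 0 ≤ p → p ≤ 1 → p * (∫ x, g x ∂(P.map (U 0)) - ∫ x, g x ∂(Q.map (V 0)))
          ≤ dTwoBar (P.map (pointProcessOf M U)) (Q.map (pointProcessOf N V)) →
        p * wassersteinDist dist (P.map (U 0)) (Q.map (V 0))
          ≤ dTwoBar (P.map (pointProcessOf M U)) (Q.map (pointProcessOf N V)) + δ := by
      intro p hp0 hp1 hp
      have h1 := mul_le_mul_of_nonneg_left hlt.le hp0
      have h2 : p * δ ≤ δ := mul_le_of_le_one_left hδ.le hp1
      linarith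
    rcases max_cases ((P.map M).real {n | 0 < n}) ((Q.map N).real {n | 0 < n}) with ⟨e, _⟩ | ⟨e, _⟩
    · rw [e]
      exact hbound _ measureReal_nonneg measureReal_le_one (by linarith)
    · rw [e]
      exact hbound _ measureReal_nonneg measureReal_le_one (by linarith)
  · exact exists_isOptimalCoupling relDiff continuous_of_discreteTopology relDiff_nonneg
      relDiff_le_one _ _
  · have hγP := hγ.1.isProbabilityMeasure
    -- The bound holds for every coupling of the point laws, so a nearly optimal one suffices at the
    -- end.
    have hupper : ∀ κ : Measure (X × X), IsCoupling κ (P.map (U 0)) (Q.map (V 0)) →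
        dTwoBar (P.map (pointProcessOf M U)) (Q.map (pointProcessOf N V))
          ≤ wassersteinDist relDiff (P.map M) (Q.map N) + cTwo γ * ∫ p, dist p.1 p.2 ∂κ := by
      intro κ hκ
      have hw0 : 0 ≤ ∫ p, dist p.1 p.2 ∂κ := integral_nonneg fun _ => dist_nonneg
      -- `Real.sSup_le` also asks for a nonnegative bound, because the supremum of the empty set is
      -- zero.
      refine Real.sSup_le ?_ (add_nonneg (wassersteinDist_nonneg relDiff_nonneg _ _)
        (mul_nonneg (cTwo_nonneg γ) hw0))
      rintro _ ⟨f, hf, rfl⟩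
      dsimp only
      rw [hlawΞ f hf, hlawH f hf]
      set F : ℕ → ℝ := fun m =>
        ∫ x, f (pointMeasureOf x) ∂(Measure.pi fun _ : Fin m => P.map (U 0))
      set G : ℕ → ℝ := fun n =>
        ∫ y, f (pointMeasureOf y) ∂(Measure.pi fun _ : Fin n => Q.map (V 0))
      have habs : ∀ (ρ : Measure X) [IsProbabilityMeasure ρ] (m : ℕ),
          |∫ x, f (pointMeasureOf x) ∂(Measure.pi fun _ : Fin m => ρ)| ≤ 1 := by
        intro ρ _ m
        have := norm_integral_le_of_norm_le_const (μ := Measure.pi fun _ : Fin m => ρ)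
          (f := fun x => f (pointMeasureOf x)) (C := 1)
          (Filter.Eventually.of_forall fun x => hfle f hf _)
        simpa using this
      have e1 : ∫ m, F m ∂(P.map M) = ∫ p, F p.1 ∂γ := by
        rw [← hγ.1.1, integral_map measurable_fst.aemeasurable
          (measurable_of_countable F).aestronglyMeasurable]
      have e2 : ∫ n, G n ∂(Q.map N) = ∫ p, G p.2 ∂γ := by
        rw [← hγ.1.2, integral_map measurable_snd.aemeasurable
          (measurable_of_countable G).aestronglyMeasurable]
      have i1 : Integrable (fun p : ℕ × ℕ => relDiff p.1 p.2) γ :=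
        integrable_nat_of_le_one γ _ fun p => by
          rw [abs_of_nonneg (relDiff_nonneg _ _)]
          exact relDiff_le_one _ _
      have i2 : Integrable (fun p : ℕ × ℕ => min (p.1 : ℝ) p.2 / max (p.1 : ℝ) p.2) γ :=
        integrable_nat_of_le_one γ _ fun p => by
          rw [abs_of_nonneg (min_div_max_nonneg _ _)]
          exact min_div_max_le_one _ _
      rw [e1, e2, ← integral_sub (integrable_nat_of_le_one γ _ fun p => habs _ _)
        (integrable_nat_of_le_one γ _ fun p => habs _ _)]
      calc |∫ p, (F p.1 - G p.2) ∂γ| ≤ ∫ p, |F p.1 - G p.2| ∂γ := abs_integral_le_integral_abs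
        _ ≤ ∫ p : ℕ × ℕ, (relDiff p.1 p.2
              + min (p.1 : ℝ) p.2 / max (p.1 : ℝ) p.2 * ∫ q, dist q.1 q.2 ∂κ) ∂γ :=
            integral_mono_of_nonneg (Filter.Eventually.of_forall fun _ => abs_nonneg _)
              (i1.add (i2.mul_const _)) (Filter.Eventually.of_forall fun p =>
                abs_integral_pi_sub_le_relDiff_add hd hκ hf p.1 p.2)
        _ = wassersteinDist relDiff (P.map M) (Q.map N) + cTwo γ * ∫ p, dist p.1 p.2 ∂κ := by
            rw [integral_add i1 (i2.mul_const _), integral_mul_const, hγ.2, cTwo_eq_integral]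
    refine le_of_forall_pos_le_add fun δ hδ => ?_
    have hc1 : cTwo γ ≤ 1 :=
      (cTwo_le_min hγ.1).trans ((min_le_left _ _).trans measureReal_le_one)
    obtain ⟨_, ⟨κ, hκ, rfl⟩, hlt⟩ := exists_lt_of_csInf_lt
      (s := {r : ℝ | ∃ κ : Measure (X × X), IsCoupling κ (P.map (U 0)) (Q.map (V 0)) ∧
        r = ∫ p, dist p.1 p.2 ∂κ}) ⟨_, _, isCoupling_prod _ _, rfl⟩
      (lt_add_of_pos_right (wassersteinDist dist (P.map (U 0)) (Q.map (V 0))) hδ)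
    have h1 := mul_le_mul_of_nonneg_left hlt.le (cTwo_nonneg γ)
    have h2 : cTwo γ * δ ≤ δ := mul_le_of_le_one_left hδ.le hc1
    linarith [hupper κ hκ]
  · rw [hPM, hQN]
    exact cTwo_le_min hγ.1
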